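/- Notation. $B^*$ is the set of finite binary strings, $B^\sharp$ the set of finite and infinite ones, $l(x)\le\infty$ the length of $x$, $x_n$ the prefix of length $\min(n,l(x))$. All machines are Turing machines with finitely many states, at least two binary work tapes, one output tape (initially empty), an instruction requesting the next input bit, and possibly a halt instruction; the next state and instruction depend on the state and the bits under the work tape heads. A general Turing machine (GTM) may append a bit to its output, move its output head, overwrite the bit under it, and delete the last output bit. An enumerable output machine (EOM) may only move its output head and replace the part of the output from the head onwards by the string to the right of the head of its second work tape, provided that this lexicographically increases the output. Programs are self-delimiting: $p\in B^\sharp$ is a program of $T$ if it is exactly the sequence of input bits that $T$ requests when it is fed with $p$. Write $T(p)\leadsto x$ if $p$ is a program of $T$ and, $T_t(p)$ being the output after $t$ instructions, for each finite $n\le l(x)$ we have $T_t(p)_n=x_n$ and $l(T_t(p))\le l(x)$ for all large enough $t$. Let $K_T(x)=\min\{l(p): p\in B^*,\ T(p)\leadsto x\}$. In a class $C$ of machines, $U\in C$ is universal if for each $T\in C$ there is $p_T\in B^*$ such that $T(p)\leadsto x$ implies $U(p_Tp)\leadsto x$ for all $p,x\in B^\sharp$. Fix any universal EOM $U^E$ and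 any universal GTM $U^G$, and put $K^E=K_{U^E}$, $K^G=K_{U^G}$. **Theorem 3.3.** There is a constant $c>0$ (depending only on $U^E$ and $U^G$) such that for every integer $n\ge 1$ there is a string $z\in B^*$ with $K^E(z)$ and $K^G(z)$ finite, $$K^E(z) > n-c, \qquad\text{and, if } n\ge 2,\qquad K^G(z)\le c\,\log_2 n .$$ In particular $K^E-K^G$ is unbounded on $B^*$: for every $m\in\mathbb N$ there is $z\in B^*$ with $K^E(z)$ and $K^G(z)$ finite and $K^E(z)-K^G(z)>m$. -/

import Mathlib

/-! Binary strings: `B^*` is `List Bool` (`false` is 0, `true` is 1), and `B^♯`, the set of all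
finite and infinite binary sequences, is `Stream'.Seq Bool`. On `List Bool` the order `<` is the
lexicographic one, with the empty string first and every proper prefix of `x` below `x`. -/

/-- A work tape: a finite chain of binary squares with one scanned square. `left` lists the squares
to the left of the scanning head, nearest first; `right` those to its right, nearest first. -/
structure WorkTape where
  left : List Bool
  head : Bool
  right : List Bool

namespace WorkTape

/-- The initial work tape: a single square containing 0. -/
def init : WorkTape := ⟨[], false, []⟩

/-- Shift the head one square to the left, appending a new square (containing 0) if necessary. -/
def shiftLeft (w : WorkTape) : WorkTape :=
  ⟨w.left.tail, w.left.headD false, w.head :: w.right⟩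

/-- Shift the head one square to the right, appending a new square (containing 0) if necessary. -/
def shiftRight (w : WorkTape) : WorkTape :=
  ⟨w.head :: w.left, w.right.headD false, w.right.tail⟩

/-- Write a bit on the scanned square. -/
def write (b : Bool) (w : WorkTape) : WorkTape := { w with head := b }

end WorkTape

/-- An output tape: its contents, and the index (from 0) of the square scanned by the output head.
Initially the output is the empty string; the first square ever produced is the one with
index 0, and the head then stands above it. -/
structure OutTape where
  str : List Bool
  pos : ℕ

namespace OutTape

def init : OutTape := ⟨[], 0⟩

/-- Append a new square at the right end and fill it with `b`. -/
def append (b : Bool) (o : OutTape) : OutTape := { o with str := o.str ++ [b] }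

/-- Shift the output head left, but not out of bounds. -/
def shiftLeft (o : OutTape) : OutTape := { o with pos := o.pos - 1 }

/-- Shift the output head right, but not out of bounds. -/
def shiftRight (o : OutTape) : OutTape :=
  if o.pos + 1 < o.str.length then { o with pos := o.pos + 1 } else o

/-- Delete the square at the right end, if there is one and it is neither the initial square nor
the square above the head. -/
def delete (o : OutTape) : OutTape :=
  if 1 < o.str.length ∧ o.pos + 1 ≠ o.str.length then { o with str := o.str.dropLast } else o

/-- Write `b` on the square above the output head (if there is such a square). -/
def write (b : Bool) (o : OutTape) : OutTape := { o with str := o.str.set o.pos b }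

/-- Replace the part of the output that starts above the head by the string `w`, but only if this
lexicographically increases the contents of the output tape. -/
def replace (w : List Bool) (o : OutTape) : OutTape :=
  if o.str < o.str.take o.pos ++ w then { o with str := o.str.take o.pos ++ w } else o

end OutTape

/-- A set `O` of output instructions. The effect of an instruction on the output tape may depend on
the string to the right of the scanning head of the second work tape. -/
class OutputInstr (O : Type) where
  act : O → List Bool → OutTape → OutTape

/-- The output instructions of a general Turing machine. -/
inductive GenOut
  | append (b : Bool)
  | left
  | right
  | delete
  | write (b : Bool)

instance : OutputInstr GenOut where
  act
    | .append b, _, o => o.append b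
    | .left, _, o => o.shiftLeft
    | .right, _, o => o.shiftRight
    | .delete, _, o => o.delete
    | .write b, _, o => o.write b

/-- The output instructions of an enumerable output machine. -/
inductive EnumOut
  | left
  | right
  | replace

instance : OutputInstr EnumOut where
  act
    | .left, _, o => o.shiftLeft
    | .right, _, o => o.shiftRight
    | .replace, w, o => o.replace w

/-- Instructions of a machine with `k + 2` work tapes: shift the head of a work tape, write
a bit on its scanned square, request an input bit (which is copied onto the scanned square of the
first work tape), or execute an output instruction. -/
inductive Instr (k : ℕ) (O : Type)
  | left (i : Fin (k + 2))
  | right (i : Fin (k + 2))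
  | write (i : Fin (k + 2)) (b : Bool)
  | request
  | output (o : O)

/-- A Turing machine with output instructions `O`: a finite set of states, one of them initial,
at least two work tapes (`extra + 2` of them), and a lookup table mapping the current state and
the bits above the work tape heads to a new state and an instruction, or to `none`
(the machine halts). -/
structure Machine (O : Type) where
  State : Type
  finite_state : Finite State
  start : State
  extra : ℕ
  table : State → (Fin (extra + 2) → Bool) → Option (State × Instr extra O)

/-- General Turing machines. -/
abbrev GTM := Machine GenOut

/-- Enumerable output machines. -/
abbrev EOM := Machine EnumOut

/-- A configuration; `read` is the number of input bits requested and received so far. -/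
structure Config {O : Type} (T : Machine O) where
  state : T.State
  work : Fin (T.extra + 2) → WorkTape
  read : ℕ
  out : OutTape

namespace Machine

variable {O : Type} (T : Machine O)

def initConfig : Config T := ⟨T.start, fun _ => WorkTape.init, 0, OutTape.init⟩

/-- The entry of the lookup table that applies to a configuration. -/
def next (c : Config T) : Option (T.State × Instr T.extra O) :=
  T.table c.state (fun i => (c.work i).head)

/-- One step on input `p`. A machine that has halted, or that requests an input bit beyond the end
of `p`, stays where it is. -/
def step [OutputInstr O] (p : Stream'.Seq Bool) (c : Config T) : Config T :=
  match T.next c with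
  | none => c
  | some (q, .left i) =>
      { c with state := q, work := Function.update c.work i (c.work i).shiftLeft }
  | some (q, .right i) =>
      { c with state := q, work := Function.update c.work i (c.work i).shiftRight }
  | some (q, .write i b) =>
      { c with state := q, work := Function.update c.work i ((c.work i).write b) }
  | some (q, .request) =>
      match p.get? c.read with
      | none => c
      | some b =>
          { c with state := q, work := Function.update c.work 0 ((c.work 0).write b),
                   read := c.read + 1 }
  | some (q, .output o) =>
      { c with state := q, out := OutputInstr.act o (c.work 1).right c.out }

/-- The configuration after `t` instructions on input `p`. -/
def run [OutputInstr O] (p : Stream'.Seq Bool) (t : ℕ) : Config T :=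
  (T.step p)^[t] T.initConfig

/-- The output string `T_t(p)` after `t` instructions on input `p`. -/
def outputAt [OutputInstr O] (p : Stream'.Seq Bool) (t : ℕ) : List Bool :=
  (T.run p t).out.str

/-- In configuration `c` the machine is about to request an input bit. -/
def Requests (c : Config T) : Prop := ∃ q, T.next c = some (q, .request)

/-- `p` is a (self-delimiting) program of `T`: it is exactly the sequence of all the bits that `T`
requests when it is fed with `p`. That is, `T` never requests a bit beyond the end of `p`, and
each bit of `p` is eventually read. -/
def IsProgram [OutputInstr O] (p : Stream'.Seq Bool) : Prop :=
  (∀ t, T.Requests (T.run p t) → (p.get? (T.run p t).read).isSome) ∧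
    ∀ i, (p.get? i).isSome → ∃ t, i < (T.run p t).read

/-- `T(p) ⇝ x`: `p` is a program of `T`, and its output converges to `x`, i.e. for each finite
`n ≤ l(x)` the first `n` bits of the output eventually agree forever with those of `x`, and the
output is eventually never longer than `x`. -/
def ConvergesTo [OutputInstr O] (p x : Stream'.Seq Bool) : Prop :=
  T.IsProgram p ∧
    ∀ n : ℕ, (n : ℕ∞) ≤ x.length' →
      ∃ s : ℕ, ∀ t ≥ s, (T.outputAt p t).take n = x.take n ∧
        ((T.outputAt p t).length : ℕ∞) ≤ x.length'

/-- `U` is universal among the machines with output instructions `O`: for each such machine `T`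
there is a finite string `c` (the compiler) such that, for all `p` and `x`, `T(p) ⇝ x` implies
`U(c p) ⇝ x`. -/
def IsUniversal [OutputInstr O] (U : Machine O) : Prop :=
  ∀ T : Machine O, ∃ c : List Bool, ∀ p x : Stream'.Seq Bool,
    T.ConvergesTo p x → U.ConvergesTo (Stream'.Seq.append (Stream'.Seq.ofList c) p) x

/-- Generalized Kolmogorov complexity `K_T(x)`: the least length of a finite program `p` with
`T(p) ⇝ x` (and `⊤` if there is none). -/
noncomputable def complexity [OutputInstr O] (x : Stream'.Seq Bool) : ℕ∞ :=
  ⨅ p : {p : List Bool // T.ConvergesTo (Stream'.Seq.ofList p) x}, (p.val.length : ℕ∞)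

end Machine

/-! ### Primitive recursiveness of the simulation of an enumerable output machine -/

/-! The output of an enumerable output machine only grows lexicographically. So for a fixed input
`p` and a fixed string `x`, the output equals `x` during one interval of time at most, and the
statement "the output on `p` is now `x`" has an eventually constant truth value, even if the output
itself never settles. Fewer than `2 ^ n` inputs are shorter than `n`, so at each time some string of
length `n` is not a current output on any of them. The first such string depends on finitely many of
these truth values only, hence stabilizes to some `z`
(`Machine.eventually_freshString_shortOutputs`). No program shorter than `n` converges to `z`, which
gives the lower bound on `K^E`. All short inputs are simulated, programs or not, so it need not be
decided which inputs are programs.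

The approximations to `z` form a primitive recursive function of `n` and the time. A general Turing
machine may revise its output freely: it creates `n` squares and sweeps over them forever, writing
the current approximation, so its output converges to `z` (`StackDriver.exists_gtm_limit`). For `n =
2 ^ k` it needs only `k`, given in unary by `k + 1` bits, and the compiler of the universal machine
adds a constant; this bounds `K^G` logarithmically. `K^E` is finite because some machine prints `z`
on the empty input. All this is combined in `exists_complexity_gap`.

Most of the work lies in building an actual machine from a primitive recursive function. The
function becomes a `ToPartrec.Code`, which compiles to a machine with four stacks; a driver keeps
the stacks on binary work tapes, evaluates the code again and again, and interprets each result as a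
request or an output command (`StackDriver.exists_gtm`). -/

/-- A function on a finite type is a finite list of values, so branching on it costs nothing. This
handles the lookup table, an arbitrary function of the state and the scanned bits. -/
theorem Primrec.of_finite_key {α β κ : Type*} [Primcodable α] [Primcodable β] [Primcodable κ]
    [Finite κ] {g : κ → α → β} (hg : ∀ i, Primrec (g i)) {key : α → κ} (hkey : Primrec key) :
    Primrec fun a => g (key a) a := by
  let e := Finite.equivFin κ
  have h : Primrec₂ fun i => g (e.symm i) := Primrec.fin_curry₁.2 fun i => hg _
  have he : Primrec e := Primrec.dom_finite _
  exact (h.comp (he.comp hkey) Primrec.id).of_eq fun a => by simp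

/-- The place of the first difference is bounded by the length of `b`, which turns the recursively
defined order into a bounded search. -/
theorem List.lt_iff_exists_take_eq_take (a b : List Bool) :
    a < b ↔ ∃ i < b.length, a.take i = b.take i ∧
      (a[i]? = none ∨ (a[i]? = some false ∧ b[i]? = some true)) := by
  induction a generalizing b with
  | nil =>
    cases b with
    | nil => simp
    | cons y b => simp only [List.nil_lt_cons, true_iff]; exact ⟨0, by simp⟩
  | cons x a ih =>
    cases b with
    | nil => simp
    | cons y b =>
      rw [List.cons_lt_cons_iff, ih]
      constructor
      · rintro (h | ⟨rfl, i, hi, h⟩)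
        · refine ⟨0, by simp, by simp, Or.inr ?_⟩
          revert h; cases x <;> cases y <;> simp
        · exact ⟨i + 1, by simpa using hi, by simpa using h⟩
      · rintro ⟨i, hi, h1, h2⟩
        cases i with
        | zero => left; simp at h2; simp [h2]
        | succ i =>
          simp only [List.take_succ_cons, List.cons.injEq] at h1
          exact Or.inr ⟨h1.1, i, by simpa using hi, h1.2, by simpa using h2⟩

theorem List.primrecRel_lt : PrimrecRel fun a b : List Bool => a < b := by
  have hfst : Primrec fun q : ℕ × List Bool × List Bool => q.2.1 := Primrec.fst.comp Primrec.snd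
  have hsnd : Primrec fun q : ℕ × List Bool × List Bool => q.2.2 := Primrec.snd.comp Primrec.snd
  have hi : Primrec fun q : ℕ × List Bool × List Bool => q.1 := Primrec.fst
  have ha := Primrec.list_getElem?.comp hfst hi
  have hb := Primrec.list_getElem?.comp hsnd hi
  have h : PrimrecRel fun (i : ℕ) (q : List Bool × List Bool) =>
      q.1.take i = q.2.take i ∧
        (q.1[i]? = none ∨ (q.1[i]? = some false ∧ q.2[i]? = some true)) :=
    (Primrec.eq.comp (Primrec.list_take.comp hi hfst) (Primrec.list_take.comp hi hsnd)).and
      ((Primrec.eq.comp ha (Primrec.const none)).or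
        ((Primrec.eq.comp ha (Primrec.const (some false))).and
          (Primrec.eq.comp hb (Primrec.const (some true)))))
  have h' := h.exists_mem_list.comp
    (Primrec.list_range.comp (Primrec.list_length.comp Primrec.snd))
    (Primrec.id (α := List Bool × List Bool))
  refine PrimrecRel.of_eq h'.primrecRel fun a b => ?_
  simp only [List.mem_range, id]
  exact (List.lt_iff_exists_take_eq_take a b).symm

/-! ### Codings of tapes and configurations -/

def WorkTape.equivProd : WorkTape ≃ List Bool × Bool × List Bool where
  toFun w := (w.left, w.head, w.right)
  invFun q := ⟨q.1, q.2.1, q.2.2⟩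
  left_inv _ := rfl
  right_inv _ := rfl

def OutTape.equivProd : OutTape ≃ List Bool × ℕ where
  toFun o := (o.str, o.pos)
  invFun q := ⟨q.1, q.2⟩
  left_inv _ := rfl
  right_inv _ := rfl

instance : Primcodable WorkTape := Primcodable.ofEquiv _ WorkTape.equivProd

instance : Primcodable OutTape := Primcodable.ofEquiv _ OutTape.equivProd

namespace WorkTape

theorem primrec_mk {α : Type*} [Primcodable α] {l r : α → List Bool} {h : α → Bool}
    (hl : Primrec l) (hh : Primrec h) (hr : Primrec r) :
    Primrec fun a => (⟨l a, h a, r a⟩ : WorkTape) :=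
  (Primrec.of_equiv_symm (e := equivProd)).comp (hl.pair (hh.pair hr))

theorem primrec_left : Primrec left :=
  Primrec.fst.comp (Primrec.of_equiv (e := equivProd))

theorem primrec_head : Primrec head :=
  (Primrec.fst.comp Primrec.snd).comp (Primrec.of_equiv (e := equivProd))

theorem primrec_right : Primrec right :=
  (Primrec.snd.comp Primrec.snd).comp (Primrec.of_equiv (e := equivProd))

theorem primrec_headD : Primrec fun l : List Bool => l.headD false :=
  (Primrec.option_getD.comp Primrec.list_head? (Primrec.const false)).of_eq fun l => by
    cases l <;> rfl

theorem primrec_shiftLeft : Primrec shiftLeft :=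
  primrec_mk (Primrec.list_tail.comp primrec_left) (primrec_headD.comp primrec_left)
    (Primrec.list_cons.comp primrec_head primrec_right)

theorem primrec_shiftRight : Primrec shiftRight :=
  primrec_mk (Primrec.list_cons.comp primrec_head primrec_left)
    (primrec_headD.comp primrec_right) (Primrec.list_tail.comp primrec_right)

theorem primrec_write : Primrec₂ write :=
  primrec_mk (primrec_left.comp Primrec.snd) Primrec.fst (primrec_right.comp Primrec.snd)

end WorkTape

namespace OutTape

theorem primrec_mk {α : Type*} [Primcodable α] {s : α → List Bool} {n : α → ℕ}
    (hs : Primrec s) (hn : Primrec n) : Primrec fun a => (⟨s a, n a⟩ : OutTape) :=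
  (Primrec.of_equiv_symm (e := equivProd)).comp (hs.pair hn)

theorem primrec_str : Primrec str :=
  Primrec.fst.comp (Primrec.of_equiv (e := equivProd))

theorem primrec_pos : Primrec pos :=
  Primrec.snd.comp (Primrec.of_equiv (e := equivProd))

theorem primrec_shiftLeft : Primrec shiftLeft :=
  primrec_mk primrec_str (Primrec.nat_sub.comp primrec_pos (Primrec.const 1))

theorem primrec_shiftRight : Primrec shiftRight :=
  Primrec.ite (Primrec.nat_lt.comp (Primrec.nat_add.comp primrec_pos (Primrec.const 1))
      (Primrec.list_length.comp primrec_str))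
    (primrec_mk primrec_str (Primrec.nat_add.comp primrec_pos (Primrec.const 1))) Primrec.id

theorem primrec_replace : Primrec₂ replace := by
  have h : Primrec fun q : List Bool × OutTape => q.2.str.take q.2.pos ++ q.1 :=
    Primrec.list_append.comp (Primrec.list_take.comp (primrec_pos.comp Primrec.snd)
      (primrec_str.comp Primrec.snd)) Primrec.fst
  exact Primrec.ite (List.primrecRel_lt.comp (primrec_str.comp Primrec.snd) h)
    (primrec_mk h (primrec_pos.comp Primrec.snd)) Primrec.snd

end OutTape

namespace Machine

variable {O : Type} (T : Machine O)

noncomputable instance : Primcodable T.State :=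
  haveI := T.finite_state
  Primcodable.ofEquiv _ (Finite.equivFin T.State)

instance : Finite T.State := T.finite_state

end Machine

namespace Config

variable {O : Type} {T : Machine O}

def equivProd : Config T ≃ T.State × (Fin (T.extra + 2) → WorkTape) × ℕ × OutTape where
  toFun c := (c.state, c.work, c.read, c.out)
  invFun q := ⟨q.1, q.2.1, q.2.2.1, q.2.2.2⟩
  left_inv _ := rfl
  right_inv _ := rfl

noncomputable instance : Primcodable (Config T) := Primcodable.ofEquiv _ equivProd

theorem primrec_mk {α : Type*} [Primcodable α] {q : α → T.State}
    {w : α → Fin (T.extra + 2) → WorkTape} {n : α → ℕ} {o : α → OutTape}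
    (hq : Primrec q) (hw : Primrec w) (hn : Primrec n) (ho : Primrec o) :
    Primrec fun a => (⟨q a, w a, n a, o a⟩ : Config T) :=
  (Primrec.of_equiv_symm (e := equivProd)).comp (hq.pair (hw.pair (hn.pair ho)))

theorem primrec_state : Primrec (state : Config T → _) :=
  Primrec.fst.comp (Primrec.of_equiv (e := equivProd))

theorem primrec_work : Primrec (work : Config T → _) :=
  (Primrec.fst.comp Primrec.snd).comp (Primrec.of_equiv (e := equivProd))

theorem primrec_work_apply (i : Fin (T.extra + 2)) : Primrec fun c : Config T => c.work i :=
  Primrec.fin_app.comp primrec_work (Primrec.const i)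

theorem primrec_read : Primrec (read : Config T → _) :=
  (Primrec.fst.comp (Primrec.snd.comp Primrec.snd)).comp (Primrec.of_equiv (e := equivProd))

theorem primrec_out : Primrec (out : Config T → _) :=
  (Primrec.snd.comp (Primrec.snd.comp Primrec.snd)).comp (Primrec.of_equiv (e := equivProd))

theorem primrec_heads :
    Primrec fun c : Config T => fun i => (c.work i).head :=
  Primrec.fin_curry.2 (WorkTape.primrec_head.comp
    (Primrec.fin_app.comp (primrec_work.comp Primrec.fst) Primrec.snd))

theorem primrec_update {α : Type*} [Primcodable α] {c : α → Config T}
    (i : Fin (T.extra + 2)) {w : α → WorkTape} (hc : Primrec c) (hw : Primrec w) :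
    Primrec fun a => Function.update (c a).work i (w a) := by
  refine Primrec.fin_curry.2 ?_
  refine (Primrec.ite (Primrec.eq.comp Primrec.snd (Primrec.const i)) (hw.comp Primrec.fst)
    (Primrec.fin_app.comp (primrec_work.comp (hc.comp Primrec.fst)) Primrec.snd)).of_eq ?_
  rintro ⟨a, j⟩
  simp only [Function.update_apply, id]

end Config

namespace Machine

variable {O : Type} [OutputInstr O] (T : Machine O)

/-- For each fixed state and scanned bits the table entry is a constant, and the step is then a
composition of tape operations; the finitely many cases are joined by `Primrec.of_finite_key`. -/
theorem primrec_step (hO : ∀ o : O, Primrec₂ (OutputInstr.act o)) :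
    Primrec₂ fun (p : List Bool) (c : Config T) => T.step (Stream'.Seq.ofList p) c := by
  have hc : Primrec fun a : List Bool × Config T => a.2 := Primrec.snd
  have hread := Config.primrec_read.comp hc
  have hwork := Config.primrec_work.comp hc
  have hout := Config.primrec_out.comp hc
  let g : T.State × (Fin (T.extra + 2) → Bool) → List Bool × Config T → Config T := fun k a =>
    match T.table k.1 k.2 with
    | none => a.2
    | some (q, .left i) =>
        { a.2 with state := q, work := Function.update a.2.work i (a.2.work i).shiftLeft }
    | some (q, .right i) =>
        { a.2 with state := q, work := Function.update a.2.work i (a.2.work i).shiftRight }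
    | some (q, .write i b) =>
        { a.2 with state := q, work := Function.update a.2.work i ((a.2.work i).write b) }
    | some (q, .request) =>
        match a.1[a.2.read]? with
        | none => a.2
        | some b =>
            { a.2 with state := q, work := Function.update a.2.work 0 ((a.2.work 0).write b),
                       read := a.2.read + 1 }
    | some (q, .output o) =>
        { a.2 with state := q, out := OutputInstr.act o (a.2.work 1).right a.2.out }
  have hg : ∀ k, Primrec (g k) := by
    intro k
    rcases h : T.table k.1 k.2 with _ | ⟨q, i | i | ⟨i, b⟩ | _ | o⟩ <;> simp only [g, h]
    · exact hc
    · exact Config.primrec_mk (Primrec.const q) (Config.primrec_update i hc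
        (WorkTape.primrec_shiftLeft.comp ((Config.primrec_work_apply i).comp hc))) hread hout
    · exact Config.primrec_mk (Primrec.const q) (Config.primrec_update i hc
        (WorkTape.primrec_shiftRight.comp ((Config.primrec_work_apply i).comp hc))) hread hout
    · exact Config.primrec_mk (Primrec.const q) (Config.primrec_update i hc
        (WorkTape.primrec_write.comp (Primrec.const b)
          ((Config.primrec_work_apply i).comp hc))) hread hout
    · have h0 : Primrec₂ fun (a : List Bool × Config T) (b : Bool) =>
          ({ a.2 with state := q, work := Function.update a.2.work 0 ((a.2.work 0).write b),
                      read := a.2.read + 1 } : Config T) :=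
        Config.primrec_mk (Primrec.const q) (Config.primrec_update 0 (hc.comp Primrec.fst)
          (WorkTape.primrec_write.comp Primrec.snd
            ((Config.primrec_work_apply 0).comp (hc.comp Primrec.fst))))
          (Primrec.nat_add.comp (hread.comp Primrec.fst) (Primrec.const 1))
          (hout.comp Primrec.fst)
      refine (Primrec.option_casesOn
        (Primrec.list_getElem?.comp Primrec.fst hread) hc h0).of_eq ?_
      rintro ⟨p, c⟩
      cases p[c.read]? <;> rfl
    · exact Config.primrec_mk (Primrec.const q) hwork hread ((hO o).comp
        (WorkTape.primrec_right.comp ((Config.primrec_work_apply 1).comp hc)) hout)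
  refine (Primrec.of_finite_key hg (key := fun a => (a.2.state, fun i => (a.2.work i).head))
    ((Config.primrec_state.comp hc).pair (Config.primrec_heads.comp hc))).of_eq ?_
  rintro ⟨p, c⟩
  simp only [g, step, next, Stream'.Seq.ofList_get?]

theorem primrec_outputAt (hO : ∀ o : O, Primrec₂ (OutputInstr.act o)) :
    Primrec₂ fun (t : ℕ) (p : List Bool) => T.outputAt (Stream'.Seq.ofList p) t := by
  have h : Primrec fun a : ℕ × List Bool =>
      (fun c => T.step (Stream'.Seq.ofList a.2) c)^[a.1] T.initConfig :=
    Primrec.nat_iterate Primrec.fst (Primrec.const _)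
      ((T.primrec_step hO).comp (Primrec.snd.comp Primrec.fst) Primrec.snd)
  exact OutTape.primrec_str.comp (Config.primrec_out.comp h)

end Machine

theorem EnumOut.primrec_act (o : EnumOut) : Primrec₂ (OutputInstr.act o) := by
  cases o
  · exact OutTape.primrec_shiftLeft.comp Primrec.snd
  · exact OutTape.primrec_shiftRight.comp Primrec.snd
  · exact OutTape.primrec_replace

/-! ### Strings that are no output of a short program of an enumerable output machine -/

/-- The only instruction that changes the contents is `replace`, and it acts only when the output
increases. The lower bound uses no other feature of the output instructions than this and their
computability. -/
theorem Machine.monotone_outputAt (T : EOM) (p : Stream'.Seq Bool) : Monotone (T.outputAt p) := by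
  refine monotone_nat_of_le_succ fun t => ?_
  have h : ∀ c : Config T, c.out.str ≤ (T.step p c).out.str := by
    intro c
    unfold Machine.step
    rcases T.next c with _ | ⟨q, i | i | ⟨i, b⟩ | _ | o⟩ <;> dsimp only <;> try exact le_rfl
    · cases p.get? c.read <;> exact le_rfl
    · cases o
      · exact le_rfl
      · simp only [OutputInstr.act, OutTape.shiftRight]
        split_ifs <;> exact le_rfl
      · simp only [OutputInstr.act, OutTape.replace]
        split_ifs with h
        · exact h.le
        · exact le_rfl
  simpa only [Machine.outputAt, Machine.run, Function.iterate_succ_apply'] using h _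

/-- The strings of length `n`. -/
def stringsOfLength (n : ℕ) : List (List Bool) :=
  Nat.rec [[]] (fun _ L => L.flatMap fun l => [true :: l, false :: l]) n

/-- The strings of length less than `n`. -/
def stringsBelow (n : ℕ) : List (List Bool) := (List.range n).flatMap stringsOfLength

theorem stringsOfLength_succ (n : ℕ) : stringsOfLength (n + 1) =
    (stringsOfLength n).flatMap fun l => [true :: l, false :: l] := rfl

theorem mem_stringsOfLength {n : ℕ} {l : List Bool} : l ∈ stringsOfLength n ↔ l.length = n := by
  induction n generalizing l with
  | zero => simp [stringsOfLength]
  | succ n ih =>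
    rw [stringsOfLength_succ]
    cases l with
    | nil => simp
    | cons b l => cases b <;> simp [ih]

theorem length_stringsOfLength (n : ℕ) : (stringsOfLength n).length = 2 ^ n := by
  induction n with
  | zero => rfl
  | succ n ih => simp [stringsOfLength_succ, List.length_flatMap, ih, pow_succ]

theorem mem_stringsBelow {n : ℕ} {l : List Bool} : l ∈ stringsBelow n ↔ l.length < n := by
  simp [stringsBelow, mem_stringsOfLength]

theorem length_stringsBelow_lt (n : ℕ) : (stringsBelow n).length < 2 ^ n := by
  induction n with
  | zero => simp [stringsBelow]
  | succ n ih =>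
    have h : stringsBelow (n + 1) = stringsBelow n ++ stringsOfLength n := by
      simp [stringsBelow, List.range_succ]
    rw [h, List.length_append, length_stringsOfLength, pow_succ]
    omega

theorem primrec_stringsOfLength : Primrec stringsOfLength := by
  have h : Primrec₂ fun (_ : ℕ) (L : List (List Bool)) =>
      L.flatMap fun l => [true :: l, false :: l] :=
    Primrec.list_flatMap Primrec.snd (Primrec.list_cons.comp
      (Primrec.list_cons.comp (Primrec.const true) Primrec.snd)
      (Primrec.list_cons.comp
        (Primrec.list_cons.comp (Primrec.const false) Primrec.snd) (Primrec.const [])))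
  exact Primrec.nat_rec₁ _ h

theorem primrec_stringsBelow : Primrec stringsBelow :=
  Primrec.list_flatMap Primrec.list_range (primrec_stringsOfLength.comp Primrec.snd)

/-- The first string of length `n` that is not in the list `L`. -/
def freshString (n : ℕ) (L : List (List Bool)) : List Bool :=
  ((stringsOfLength n).filter (· ∉ L)).headI

/-- Pigeonhole: `L` is too short to contain all `2 ^ n` strings, so `headI` never falls back on its
default value. -/
theorem freshString_mem {n : ℕ} {L : List (List Bool)} (hL : L.length < 2 ^ n) :
    freshString n L ∈ (stringsOfLength n).filter (· ∉ L) := by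
  have h : (stringsOfLength n).filter (· ∉ L) ≠ [] := by
    intro h
    have hsub : ∀ v : List.Vector Bool n, v.toList ∈ L := fun v => by
      by_contra hv
      have hmem : v.toList ∈ (stringsOfLength n).filter (· ∉ L) :=
        List.mem_filter.2 ⟨mem_stringsOfLength.2 v.toList_length, by simpa using hv⟩
      rw [h] at hmem
      exact List.not_mem_nil hmem
    have hcard : Fintype.card (List.Vector Bool n) ≤ L.toFinset.card :=
      Finset.card_le_card_of_injOn List.Vector.toList (by simpa using hsub)
        List.Vector.toList_injective.injOn
    rw [card_vector, Fintype.card_bool] at hcard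
    have := L.toFinset_card_le
    omega
  obtain ⟨a, l, hl⟩ := List.exists_cons_of_ne_nil h
  rw [freshString, hl]
  simp

theorem length_freshString {n : ℕ} {L : List (List Bool)} (hL : L.length < 2 ^ n) :
    (freshString n L).length = n :=
  mem_stringsOfLength.1 (List.mem_filter.1 (freshString_mem hL)).1

theorem freshString_notMem {n : ℕ} {L : List (List Bool)} (hL : L.length < 2 ^ n) :
    freshString n L ∉ L := by
  simpa using (List.mem_filter.1 (freshString_mem hL)).2

theorem primrec_freshString : Primrec₂ freshString := by
  have h : PrimrecRel fun (z : List Bool) (L : List (List Bool)) => z ∉ L :=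
    PrimrecRel.of_eq (PrimrecRel.exists_mem_list Primrec.eq).swap.not fun a L => by simp
  exact Primrec.list_headI.comp
    (h.listFilter.comp (primrec_stringsOfLength.comp Primrec.fst) Primrec.snd)

namespace Machine

variable {O : Type} [OutputInstr O] (T : Machine O)

/-- The outputs after `t` instructions on the inputs of length less than `n`. -/
def shortOutputs (n t : ℕ) : List (List Bool) :=
  (stringsBelow n).map fun p => T.outputAt (Stream'.Seq.ofList p) t

theorem length_shortOutputs_lt (n t : ℕ) : (T.shortOutputs n t).length < 2 ^ n := by
  simpa [shortOutputs] using length_stringsBelow_lt n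

theorem primrec_freshString_shortOutputs (hO : ∀ o : O, Primrec₂ (OutputInstr.act o)) :
    Primrec₂ fun n t => freshString n (T.shortOutputs n t) :=
  primrec_freshString.comp Primrec.fst (Primrec.list_map (primrec_stringsBelow.comp Primrec.fst)
    ((T.primrec_outputAt hO).comp (Primrec.snd.comp Primrec.fst) Primrec.snd))

end Machine

open Filter in
/-- On inputs of length less than `n`, an enumerable output machine eventually avoids a string of
length `n` that is computable in the limit. -/
theorem Machine.eventually_freshString_shortOutputs (T : EOM) (n : ℕ) :
    ∃ z : List Bool, z.length = n ∧
      ∀ᶠ t in atTop, freshString n (T.shortOutputs n t) = z ∧ z ∉ T.shortOutputs n t := by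
  -- If the output is `x` at time `s` and again at arbitrarily late times, monotonicity squeezes it
  -- to `x` at all times from `s` on. Otherwise it is eventually never `x`.
  have key : ∀ p x : List Bool, ∃ Q : Prop,
      ∀ᶠ t in atTop, (T.outputAt (Stream'.Seq.ofList p) t = x ↔ Q) := by
    intro p x
    have hmono := T.monotone_outputAt (Stream'.Seq.ofList p)
    by_cases h : ∃ᶠ t in atTop, T.outputAt (Stream'.Seq.ofList p) t = x
    · obtain ⟨s, hs⟩ := h.exists
      refine ⟨True, eventually_atTop.2 ⟨s, fun t ht => ?_⟩⟩
      obtain ⟨t', ht', hx⟩ := (frequently_atTop.1 h) t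
      simp only [iff_true]
      exact le_antisymm (hx ▸ hmono ht') (hs ▸ hmono ht)
    · exact ⟨False, (not_frequently.1 h).mono fun t ht => by simpa using ht⟩
  choose Q hQ using key
  have hall : ∀ᶠ t in atTop, ∀ p ∈ {p | p ∈ stringsBelow n}, ∀ x ∈ {x | x ∈ stringsOfLength n},
      (T.outputAt (Stream'.Seq.ofList p) t = x ↔ Q p x) :=
    (eventually_all_finite (List.finite_toSet _)).2 fun p _ =>
      (eventually_all_finite (List.finite_toSet _)).2 fun x _ => hQ p x
  obtain ⟨s, hs⟩ := eventually_atTop.1 hall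
  -- The fresh string depends only on which strings of length `n` are current outputs, and this no
  -- longer changes after time `s`.
  have heq : ∀ t ≥ s, freshString n (T.shortOutputs n t) = freshString n (T.shortOutputs n s) := by
    intro t ht
    unfold freshString
    congr 1
    refine List.filter_congr fun x hx => ?_
    have : x ∈ T.shortOutputs n t ↔ x ∈ T.shortOutputs n s := by
      simp only [Machine.shortOutputs, List.mem_map]
      exact exists_congr fun p => and_congr_right fun hp =>
        (hs t ht p hp x hx).trans (hs s le_rfl p hp x hx).symm
    simp [this]
  refine ⟨_, length_freshString (T.length_shortOutputs_lt n s),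
    eventually_atTop.2 ⟨s, fun t ht => ⟨heq t ht, ?_⟩⟩⟩
  rw [← heq t ht]
  exact freshString_notMem (T.length_shortOutputs_lt n t)

/-! ### Convergence to a finite string -/

theorem Stream'.Seq.length'_ofList {α : Type*} (l : List α) :
    (Stream'.Seq.ofList l).length' = (l.length : ℕ∞) := by
  rw [Stream'.Seq.length'_of_terminates (Stream'.Seq.terminates_ofList l),
    ← Stream'.Seq.length_toList, Stream'.Seq.toList_ofList]

theorem Stream'.Seq.take_ofList {α : Type*} (l : List α) (n : ℕ) :
    (Stream'.Seq.ofList l).take n = l.take n := by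
  ext1 i
  rw [Stream'.Seq.getElem?_take, Stream'.Seq.ofList_get?, List.getElem?_take]

/-- Taking the prefix length equal to `z.length`, the bound on the length of the output turns
agreement of prefixes into equality. -/
theorem Machine.convergesTo_ofList_iff {O : Type} [OutputInstr O] {T : Machine O}
    {p : Stream'.Seq Bool} {z : List Bool} : T.ConvergesTo p (Stream'.Seq.ofList z) ↔
      T.IsProgram p ∧ ∀ᶠ t in Filter.atTop, T.outputAt p t = z := by
  simp only [Machine.ConvergesTo, Stream'.Seq.length'_ofList, Stream'.Seq.take_ofList,
    Nat.cast_le, Filter.eventually_atTop]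
  refine and_congr_right fun _ => ⟨fun h => ?_, fun ⟨s, hs⟩ n _ => ⟨s, fun t ht => ?_⟩⟩
  · obtain ⟨s, hs⟩ := h z.length le_rfl
    refine ⟨s, fun t ht => ?_⟩
    obtain ⟨h1, h2⟩ := hs t ht
    rwa [List.take_of_length_le h2, List.take_length] at h1
  · rw [hs t ht]
    exact ⟨rfl, le_rfl⟩

/-! ### Hoare-style reasoning about iterates -/

/-- Every point of `A` reaches `B` by iterating `f`, and `P` holds on the way. -/
def Leads {α : Type*} (f : α → α) (P A B : α → Prop) : Prop :=
  ∀ a, A a → ∃ n, B (f^[n] a) ∧ ∀ m ≤ n, P (f^[m] a)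

/-- `Leads` with at least one step. -/
def LeadsPos {α : Type*} (f : α → α) (P A B : α → Prop) : Prop :=
  ∀ a, A a → ∃ n > 0, B (f^[n] a) ∧ ∀ m ≤ n, P (f^[m] a)

section Leads

variable {α : Type*} {f : α → α} {P P' A B C : α → Prop}

theorem LeadsPos.leads (h : LeadsPos f P A B) : Leads f P A B := fun a ha =>
  let ⟨n, _, hn⟩ := h a ha
  ⟨n, hn⟩

theorem Leads.of_imp (h : ∀ a, A a → B a) (hP : ∀ a, A a → P a) : Leads f P A B := fun a ha =>
  ⟨0, h a ha, fun m hm => by simpa [Nat.le_zero.1 hm] using hP a ha⟩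

theorem Leads.mono (h : Leads f P A B) (hP : ∀ a, P a → P' a) : Leads f P' A B := fun a ha =>
  let ⟨n, hn, hm⟩ := h a ha
  ⟨n, hn, fun m h => hP _ (hm m h)⟩

theorem LeadsPos.mono (h : LeadsPos f P A B) (hP : ∀ a, P a → P' a) : LeadsPos f P' A B :=
  fun a ha =>
    let ⟨n, h0, hn, hm⟩ := h a ha
    ⟨n, h0, hn, fun m h => hP _ (hm m h)⟩

theorem iterate_path_add {a : α} {n n' : ℕ} (h : ∀ m ≤ n, P (f^[m] a))
    (h' : ∀ m ≤ n', P (f^[m] (f^[n] a))) : ∀ m ≤ n' + n, P (f^[m] a) := by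
  intro m hm
  rcases le_total m n with hmn | hmn
  · exact h m hmn
  · have := h' (m - n) (by omega)
    rwa [← Function.iterate_add_apply, Nat.sub_add_cancel hmn] at this

theorem Leads.trans (h : Leads f P A B) (h' : Leads f P B C) : Leads f P A C := by
  intro a ha
  obtain ⟨n, hB, hP⟩ := h a ha
  obtain ⟨n', hC, hP'⟩ := h' _ hB
  exact ⟨n' + n, by rwa [Function.iterate_add_apply], iterate_path_add hP hP'⟩

theorem Leads.trans_leadsPos (h : Leads f P A B) (h' : LeadsPos f P B C) : LeadsPos f P A C := by
  intro a ha
  obtain ⟨n, hB, hP⟩ := h a ha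
  obtain ⟨n', h0, hC, hP'⟩ := h' _ hB
  exact ⟨n' + n, by omega, by rwa [Function.iterate_add_apply], iterate_path_add hP hP'⟩

theorem LeadsPos.trans_leads (h : LeadsPos f P A B) (h' : Leads f P B C) : LeadsPos f P A C := by
  intro a ha
  obtain ⟨n, h0, hB, hP⟩ := h a ha
  obtain ⟨n', hC, hP'⟩ := h' _ hB
  exact ⟨n' + n, by omega, by rwa [Function.iterate_add_apply], iterate_path_add hP hP'⟩

theorem LeadsPos.of_step (h : ∀ a, A a → B (f a)) (hA : ∀ a, A a → P a)
    (hB : ∀ a, B a → P a) : LeadsPos f P A B := fun a ha =>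
  ⟨1, one_pos, h a ha, fun m hm => by
    rcases Nat.le_one_iff_eq_zero_or_eq_one.1 hm with rfl | rfl
    · exact hA a ha
    · exact hB _ (h a ha)⟩

/-- Each passage from one `A i` to the next takes at least one step, so the passages cover all
times; with passages of length zero this would fail. -/
theorem LeadsPos.forall_iterate {A : ℕ → α → Prop} {s : ℕ}
    (h : ∀ i ≥ s, LeadsPos f P (A i) (A (i + 1))) {a : α} (ha : A s a) (t : ℕ) : P (f^[t] a) := by
  induction t using Nat.strong_induction_on generalizing s a with
  | _ t ih =>
    obtain ⟨n, h0, hA, hP⟩ := h s le_rfl a ha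
    rcases le_or_gt t n with htn | htn
    · exact hP t htn
    · have := ih (t - n) (by omega) (fun i hi => h i (by omega)) hA
      rwa [← Function.iterate_add_apply, Nat.sub_add_cancel htn.le] at this

theorem LeadsPos.exists_iterate {P : ℕ → α → Prop} {A : ℕ → α → Prop} {s : ℕ}
    (h : ∀ i ≥ s, LeadsPos f (P i) (A i) (A (i + 1))) {a : α} (ha : A s a) (N : ℕ) :
    ∃ t ≥ N, A (s + N) (f^[t] a) := by
  induction N with
  | zero => exact ⟨0, le_rfl, ha⟩
  | succ N ih =>
    obtain ⟨t, ht, hA⟩ := ih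
    obtain ⟨n, h0, hA', -⟩ := h (s + N) (by omega) _ hA
    exact ⟨n + t, by omega, by rw [Function.iterate_add_apply]; exact hA'⟩

end Leads

/-! ### Machines whose table entries are sequences of instructions -/

namespace Instr

variable {k : ℕ} {O : Type}

theorem finite [Finite O] : Finite (Instr k O) := by
  let g : Instr k O → (Fin (k + 2) × Fin 4) ⊕ Option O := fun
    | .left i => .inl (i, 0)
    | .right i => .inl (i, 1)
    | .write i false => .inl (i, 2)
    | .write i true => .inl (i, 3)
    | .request => .inr none
    | .output o => .inr (some o)
  refine Finite.of_injective g ?_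
  rintro (i | i | ⟨i, _ | _⟩ | _ | o) (j | j | ⟨j, _ | _⟩ | _ | o') h <;> simp_all [g]

/-- An instruction that only concerns the work tapes. -/
def IsWork : Instr k O → Prop
  | .request => False
  | .output _ => False
  | _ => True

/-- The effect of an instruction on the work tapes, requests excepted. -/
def actWork (w : Fin (k + 2) → WorkTape) : Instr k O → Fin (k + 2) → WorkTape
  | .left i => Function.update w i (w i).shiftLeft
  | .right i => Function.update w i (w i).shiftRight
  | .write i b => Function.update w i ((w i).write b)
  | _ => w

end Instr

theorem Option.pmap_of_eq_some {α β : Type*} {P : α → Prop} {f : ∀ a, P a → β} {o : Option α}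
    {a : α} (h : o = some a) (H : ∀ a ∈ o, P a) : o.pmap f H = some (f a (H a h)) := by
  subst h
  rfl

namespace Machine

theorem step_of_next_request {O : Type} [OutputInstr O] {T : Machine O} {p : Stream'.Seq Bool}
    {c : Config T} {q : T.State} {b : Bool} (h : T.next c = some (q, .request))
    (hp : p.get? c.read = some b) : T.step p c =
      { c with state := q, work := Function.update c.work 0 ((c.work 0).write b),
               read := c.read + 1 } := by
  simp only [step, h, hp]

theorem run_eq_of_step_eq {O : Type} [OutputInstr O] {T : Machine O} {p : Stream'.Seq Bool} {t : ℕ}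
    (h : T.step p (T.run p t) = T.run p t) {t' : ℕ} (ht : t ≤ t') : T.run p t' = T.run p t := by
  obtain ⟨n, rfl⟩ := Nat.exists_eq_add_of_le' ht
  rw [run, Function.iterate_add_apply]
  exact Function.iterate_fixed h n

theorem step_eq_of_requests {O : Type} [OutputInstr O] {T : Machine O} {p : Stream'.Seq Bool}
    {c : Config T} (h : T.Requests c) (hp : p.get? c.read = none) : T.step p c = c := by
  obtain ⟨q, hq⟩ := h
  simp only [step, hq, hp]

section Macro

variable {Q O : Type} {k : ℕ}
  (tbl : Q → (Fin (k + 2) → Bool) → Option (Q × List (Instr k O)))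

/-- Execute the pending instructions, and consult the table when there are none. An empty
sequence of instructions is replaced by an ineffective one. -/
def macroTable : Q × List (Instr k O) → (Fin (k + 2) → Bool) →
    Option ((Q × List (Instr k O)) × Instr k O)
  | (q, i :: l), _ => some ((q, l), i)
  | (q, []), h => (tbl q h).map fun r => ((r.1, r.2.tail), r.2.headD (.write 0 (h 0)))

variable {tbl} {A : Set Q} {L : ℕ}

theorem macroTable_mem
    (closed : ∀ q ∈ A, ∀ h, ∀ r ∈ tbl q h, r.1 ∈ A ∧ r.2.length ≤ L)
    {x : Q × List (Instr k O)} (hx : x.1 ∈ A ∧ x.2.length ≤ L) (h : Fin (k + 2) → Bool) :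
    ∀ r ∈ macroTable tbl x h, r.1.1 ∈ A ∧ r.1.2.length ≤ L := by
  obtain ⟨q, _ | ⟨i, l⟩⟩ := x
  · intro r hr
    obtain ⟨r', hr', rfl⟩ := Option.map_eq_some_iff.1 hr
    have := closed q hx.1 h r' hr'
    simpa using ⟨this.1, by omega⟩
  · rintro r ⟨⟩
    simp only [List.length_cons] at hx
    exact ⟨hx.1, by dsimp only; omega⟩

/-- `Q` and the lists of pending instructions may form infinite types. A finite set `A` closed under
the table and a bound `L` on its entries are what make the resulting machine finite. -/
theorem finite_macroState [Finite O] (hA : A.Finite) (L : ℕ) :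
    Finite {x : Q × List (Instr k O) // x.1 ∈ A ∧ x.2.length ≤ L} :=
  haveI := Instr.finite (k := k) (O := O)
  (hA.prod (List.finite_length_le (Instr k O) L)).to_subtype

/-- The machine that executes the table `tbl` of sequences of instructions. -/
def ofMacro [Finite O] (hA : A.Finite) (start : Q) (hstart : start ∈ A)
    (closed : ∀ q ∈ A, ∀ h, ∀ r ∈ tbl q h, r.1 ∈ A ∧ r.2.length ≤ L) : Machine O where
  State := {x : Q × List (Instr k O) // x.1 ∈ A ∧ x.2.length ≤ L}
  finite_state := finite_macroState hA L
  start := ⟨(start, []), hstart, Nat.zero_le _⟩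
  extra := k
  table x h := (macroTable tbl x.1 h).pmap (fun r hr => (⟨r.1, hr⟩, r.2))
    (macroTable_mem closed x.2 h)

variable [Finite O] {hA : A.Finite} {start : Q} {hstart : start ∈ A}
  {closed : ∀ q ∈ A, ∀ h, ∀ r ∈ tbl q h, r.1 ∈ A ∧ r.2.length ≤ L}

/-- The configuration `c` is in state `q` with pending instructions `l`, has read `r` bits, and its
work and output tapes are `w` and `o`. -/
def MacroConfig (c : Config (ofMacro hA start hstart closed)) (q : Q) (l : List (Instr k O))
    (w : Fin (k + 2) → WorkTape) (r : ℕ) (o : OutTape) : Prop :=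
  c.state.1 = (q, l) ∧ c.work = w ∧ c.read = r ∧ c.out = o

local notation "M" => ofMacro hA start hstart closed

theorem macroConfig_initConfig :
    MacroConfig (M).initConfig start [] (fun _ => WorkTape.init) 0 OutTape.init :=
  ⟨rfl, rfl, rfl, rfl⟩

theorem next_ofMacro {c : Config M} {x : Q × List (Instr k O)} {i : Instr k O}
    (h : macroTable tbl c.state.1 (fun j => (c.work j).head) = some (x, i)) :
    ∃ y, y.1 = x ∧ (M).next c = some (y, i) :=
  ⟨⟨x, macroTable_mem closed c.state.2 _ _ h⟩, rfl,
    Option.pmap_of_eq_some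
      (P := fun r : (Q × List (Instr k O)) × Instr k O => r.1.1 ∈ A ∧ r.1.2.length ≤ L)
      (f := fun r hr => ((⟨r.1, hr⟩ : (M).State), r.2)) h (macroTable_mem closed c.state.2 _)⟩

theorem next_ofMacro_eq_none {c : Config M}
    (h : macroTable tbl c.state.1 (fun j => (c.work j).head) = none) : (M).next c = none := by
  unfold next
  simp only [ofMacro, Option.pmap_eq_none_iff]
  exact h

variable [OutputInstr O] {p : Stream'.Seq Bool} {q q' : Q} {l : List (Instr k O)} {i : Instr k O}
  {w : Fin (k + 2) → WorkTape} {r : ℕ} {o : OutTape}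

theorem MacroConfig.step_work_aux {c : Config M} {x : Q × List (Instr k O)}
    (h : macroTable tbl c.state.1 (fun j => (c.work j).head) = some (x, i)) (hi : i.IsWork) :
    MacroConfig ((M).step p c) x.1 x.2 (i.actWork c.work) c.read c.out := by
  obtain ⟨y, rfl, hy⟩ := next_ofMacro h
  unfold MacroConfig step
  rw [hy]
  cases i <;> first | exact hi.elim | exact ⟨rfl, rfl, rfl, rfl⟩

theorem MacroConfig.step_work {c : Config M} (hc : MacroConfig c q (i :: l) w r o)
    (hi : i.IsWork) : MacroConfig ((M).step p c) q l (i.actWork w) r o := by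
  obtain ⟨hs, rfl, rfl, rfl⟩ := hc
  exact step_work_aux (x := (q, l)) (by rw [hs]; rfl) hi

theorem MacroConfig.step_output {c : Config M} {a : O}
    (hc : MacroConfig c q (.output a :: l) w r o) :
    MacroConfig ((M).step p c) q l w r (OutputInstr.act a (w 1).right o) := by
  obtain ⟨hs, rfl, rfl, rfl⟩ := hc
  obtain ⟨y, hy, hy'⟩ := next_ofMacro (c := c) (x := (q, l)) (i := .output a) (by rw [hs]; rfl)
  unfold MacroConfig step
  rw [hy']
  exact ⟨hy, rfl, rfl, rfl⟩

theorem leads_work (q : Q) (l l' : List (Instr k O)) (hl : ∀ i ∈ l, i.IsWork)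
    (w : Fin (k + 2) → WorkTape) (r : ℕ) (o : OutTape) :
    Leads ((M).step p) (fun c => c.out = o) (fun c => MacroConfig c q (l ++ l') w r o)
      (fun c => MacroConfig c q l' (l.foldl Instr.actWork w) r o) := by
  induction l generalizing w with
  | nil => exact Leads.of_imp (fun _ => id) fun _ h => h.2.2.2
  | cons i l ih =>
    simp only [List.mem_cons, forall_eq_or_imp] at hl
    refine Leads.trans (LeadsPos.leads (LeadsPos.of_step
      (B := fun c => MacroConfig c q (l ++ l') (i.actWork w) r o) (fun c hc => hc.step_work hl.1)
      (fun _ h => h.2.2.2) fun _ h => h.2.2.2)) (ih hl.2 _)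

/-- Look up the table and execute the work tape instructions `l` at the beginning of its entry. -/
theorem leads_lookup {l l' : List (Instr k O)} (hl : ∀ i ∈ l, i.IsWork)
    (h : tbl q (fun j => (w j).head) = some (q', l ++ l')) (hne : l = [] → l' = [])
    (r : ℕ) (o : OutTape) :
    LeadsPos ((M).step p) (fun c => c.out = o) (fun c => MacroConfig c q [] w r o)
      (fun c => MacroConfig c q' l' (l.foldl Instr.actWork w) r o) := by
  cases l with
  | nil =>
    obtain rfl := hne rfl
    refine LeadsPos.of_step ?_ (fun _ h => h.2.2.2) fun _ h => h.2.2.2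
    rintro c ⟨hs, rfl, rfl, rfl⟩
    -- An empty entry still costs one step, which rewrites the scanned bit of the first work tape
    -- and so leaves all tapes unchanged.
    obtain ⟨i, hi⟩ : ∃ i : Instr k O, i = .write 0 (c.work 0).head := ⟨_, rfl⟩
    have e : i.actWork c.work = c.work := by subst hi; exact Function.update_eq_self _ _
    have := MacroConfig.step_work_aux (p := p) (c := c) (x := (q', [])) (i := i)
      (by rw [hs]; simp [macroTable, h, hi]; rfl) (by subst hi; trivial)
    exact Eq.mp (congrArg (fun w => MacroConfig ((M).step p c) q' [] w c.read c.out) e) this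
  | cons i l =>
    simp only [List.mem_cons, forall_eq_or_imp] at hl
    refine LeadsPos.trans_leads (LeadsPos.of_step
      (B := fun c => MacroConfig c q' (l ++ l') (i.actWork w) r o) ?_
      (fun _ h => h.2.2.2) fun _ h => h.2.2.2) (leads_work _ _ _ hl.2 _ _ _)
    rintro c ⟨hs, rfl, rfl, rfl⟩
    exact MacroConfig.step_work_aux (x := (q', l ++ l'))
      (by rw [hs]; simp [macroTable, h]) hl.1

/-- Look up the table and execute the request at the beginning of its entry. -/
theorem leads_lookup_request {b : Bool}
    (h : tbl q (fun j => (w j).head) = some (q', .request :: l)) (hp : p.get? r = some b) :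
    LeadsPos ((M).step p) (fun c => c.out = o) (fun c => MacroConfig c q [] w r o)
      (fun c => MacroConfig c q' l (Function.update w 0 ((w 0).write b)) (r + 1) o) := by
  refine LeadsPos.of_step ?_ (fun _ h => h.2.2.2) fun _ h => h.2.2.2
  rintro c ⟨hs, rfl, rfl, rfl⟩
  obtain ⟨y, hy, hy'⟩ := next_ofMacro (c := c) (x := (q', l)) (i := .request)
    (by rw [hs]; simp [macroTable, h])
  rw [step_of_next_request hy' hp]
  exact ⟨hy, rfl, rfl, rfl⟩

end Macro

end Machine

/-! ### A general Turing machine that iterates a computable function -/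

instance : Finite GenOut := by
  let g : GenOut → Fin 4 × Bool := fun
    | .append b => (0, b)
    | .left => (1, false)
    | .right => (1, true)
    | .delete => (2, false)
    | .write b => (3, b)
  refine Finite.of_injective g ?_
  rintro (b | _ | _ | _ | b) (b' | _ | _ | _ | b') h <;> simp_all [g]

/-! ### Substatements of stack machine statements -/

namespace Turing.TM2

variable {K Λ σ : Type*} {Γ : K → Type*}

theorem mem_stmts₁_push {k : K} {f : σ → Γ k} {q : Stmt Γ Λ σ} : q ∈ stmts₁ (.push k f q) := by
  simp [stmts₁, stmts₁_self]

theorem mem_stmts₁_peek {k : K} {f : σ → Option (Γ k) → σ} {q : Stmt Γ Λ σ} :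
    q ∈ stmts₁ (.peek k f q) := by
  simp [stmts₁, stmts₁_self]

theorem mem_stmts₁_pop {k : K} {f : σ → Option (Γ k) → σ} {q : Stmt Γ Λ σ} :
    q ∈ stmts₁ (.pop k f q) := by
  simp [stmts₁, stmts₁_self]

theorem mem_stmts₁_load {a : σ → σ} {q : Stmt Γ Λ σ} : q ∈ stmts₁ (.load a q) := by
  simp [stmts₁, stmts₁_self]

theorem mem_stmts₁_branch {f : σ → Bool} {q₁ q₂ : Stmt Γ Λ σ} (b : Bool) :
    (bif b then q₁ else q₂) ∈ stmts₁ (.branch f q₁ q₂) := by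
  cases b <;> simp [stmts₁, stmts₁_self]

theorem some_mem_stmts {M : Λ → Stmt Γ Λ σ} {S : Finset Λ} {l : Λ} (h : l ∈ S) :
    some (M l) ∈ stmts M S := by
  classical
  exact Finset.some_mem_insertNone.2 (Finset.mem_biUnion.2 ⟨l, h, stmts₁_self⟩)

end Turing.TM2

/-! ### Stacks on binary work tapes and the table of the driver -/

namespace StackDriver

open Turing PartrecToTM2 ToPartrec

/-- The three bits that represent a stack symbol; `000` is the bottom of a stack. -/
def bits : Γ' → Fin 3 → Bool
  | .consₗ => ![true, false, false]
  | .cons => ![true, false, true]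
  | .bit0 => ![true, true, false]
  | .bit1 => ![true, true, true]

def symbol (f : Fin 3 → Bool) : Option Γ' :=
  if f 0 then
    some (if f 1 then (if f 2 then .bit1 else .bit0) else (if f 2 then .cons else .consₗ))
  else none

theorem symbol_bits (a : Γ') : symbol (bits a) = some a := by cases a <;> rfl

/-- The work tape that holds the `j`-th bits of the symbols on a stack. -/
def tape (k : K') (j : Fin 3) : Fin (12 + 2) :=
  match k with
  | .main => ⟨2 + j, by omega⟩
  | .rev => ⟨5 + j, by omega⟩
  | .aux => ⟨8 + j, by omega⟩
  | .stack => ⟨11 + j, by omega⟩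

theorem tape_inj {k k' : K'} {j j' : Fin 3} : tape k j = tape k' j' ↔ k = k' ∧ j = j' := by
  cases k <;> cases k' <;> revert j j' <;> decide

theorem tape_ne_zero (k : K') (j : Fin 3) : tape k j ≠ 0 := by
  cases k <;> revert j <;> decide

def top (h : Fin (12 + 2) → Bool) (k : K') : Option Γ' := symbol fun j => h (tape k j)

abbrev WInstr := Instr 12 GenOut

def pushInstrs (k : K') (a : Γ') : List WInstr :=
  [.right (tape k 0), .write (tape k 0) (bits a 0), .right (tape k 1),
    .write (tape k 1) (bits a 1), .right (tape k 2), .write (tape k 2) (bits a 2)]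

/-- Nothing is erased: the popped bits remain to the right of the heads, where `Holds` ignores them
and the next push overwrites them. -/
def popInstrs (k : K') : List WInstr :=
  [.left (tape k 0), .left (tape k 1), .left (tape k 2)]

/-- The work tapes `w` hold the stacks `S`. -/
def Holds (w : Fin (12 + 2) → WorkTape) (S : K' → List Γ') : Prop :=
  ∀ k j, (w (tape k j)).head :: (w (tape k j)).left = (S k).map (bits · j) ++ [false]

theorem isWork_pushInstrs (k : K') (a : Γ') : ∀ i ∈ pushInstrs k a, i.IsWork := by
  simp [pushInstrs, Instr.IsWork]

theorem isWork_popInstrs (k : K') : ∀ i ∈ popInstrs k, i.IsWork := by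
  simp [popInstrs, Instr.IsWork]

theorem foldl_pushInstrs_apply (w : Fin (12 + 2) → WorkTape) (k : K') (a : Γ')
    (i : Fin (12 + 2)) : (pushInstrs k a).foldl Instr.actWork w i =
      if i = tape k 0 then (w i).shiftRight.write (bits a 0)
      else if i = tape k 1 then (w i).shiftRight.write (bits a 1)
      else if i = tape k 2 then (w i).shiftRight.write (bits a 2) else w i := by
  have h01 : tape k 0 ≠ tape k 1 := by simp [tape_inj]
  have h02 : tape k 0 ≠ tape k 2 := by simp [tape_inj]
  have h12 : tape k 1 ≠ tape k 2 := by simp [tape_inj]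
  simp only [pushInstrs, List.foldl, Instr.actWork, Function.update_apply, h01.symm,
    h02.symm, h12.symm, if_false, if_true]
  split_ifs <;> simp_all

theorem foldl_popInstrs_apply (w : Fin (12 + 2) → WorkTape) (k : K') (i : Fin (12 + 2)) :
    (popInstrs k).foldl Instr.actWork w i =
      if i = tape k 0 ∨ i = tape k 1 ∨ i = tape k 2 then (w i).shiftLeft else w i := by
  have h01 : tape k 0 ≠ tape k 1 := by simp [tape_inj]
  have h02 : tape k 0 ≠ tape k 2 := by simp [tape_inj]
  have h12 : tape k 1 ≠ tape k 2 := by simp [tape_inj]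
  simp only [popInstrs, List.foldl, Instr.actWork, Function.update_apply, h01.symm,
    h02.symm, h12.symm, if_false]
  split_ifs <;> simp_all

theorem Holds.init : Holds (fun _ => WorkTape.init) (K'.elim [] [] [] []) := by
  intro k j
  cases k <;> rfl

theorem Holds.update_zero {w : Fin (12 + 2) → WorkTape} {S : K' → List Γ'} (h : Holds w S)
    (t : WorkTape) : Holds (Function.update w 0 t) S := fun k j => by
  simpa [Function.update_apply, tape_ne_zero] using h k j

theorem Holds.top_eq {w : Fin (12 + 2) → WorkTape} {S : K' → List Γ'} (h : Holds w S) (k : K') :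
    top (fun i => (w i).head) k = (S k).head? := by
  have hk := h k
  unfold top
  cases hS : S k with
  | nil =>
    simp only [hS, List.map_nil, List.nil_append, List.cons.injEq] at hk
    simp [hk, symbol]
  | cons a l =>
    simp only [hS, List.map_cons, List.cons_append, List.cons.injEq] at hk
    simp only [hk, List.head?_cons, symbol_bits]

theorem Holds.push {w : Fin (12 + 2) → WorkTape} {S : K' → List Γ'} (h : Holds w S) (k : K') (a : Γ') :
    Holds ((pushInstrs k a).foldl Instr.actWork w) (Function.update S k (a :: S k)) := by
  intro k' j
  rw [foldl_pushInstrs_apply]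
  by_cases hk : k' = k
  · subst hk
    have := h k' j
    fin_cases j <;>
      simpa [tape_inj, WorkTape.shiftRight, WorkTape.write] using this
  · simpa [tape_inj, hk] using h k' j

theorem Holds.pop {w : Fin (12 + 2) → WorkTape} {S : K' → List Γ'} (h : Holds w S) {k : K'} {a : Γ'}
    {l : List Γ'} (hS : S k = a :: l) :
    Holds ((popInstrs k).foldl Instr.actWork w) (Function.update S k l) := by
  intro k' j
  rw [foldl_popInstrs_apply]
  by_cases hk : k' = k
  · subst hk
    have h' := h k' j
    rw [hS, List.map_cons, List.cons_append, List.cons.injEq] at h'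
    have hj : tape k' j = tape k' 0 ∨ tape k' j = tape k' 1 ∨ tape k' j = tape k' 2 := by
      simp only [tape_inj, true_and]; omega
    rw [if_pos hj, Function.update_self]
    cases l <;> simp [WorkTape.shiftLeft, h'.2]
  · simpa [tape_inj, hk] using h k' j

/-- The states of the driver. -/
inductive State
  | stmt (s : Stmt') (v : Option Γ')
  | digits (acc : List Γ')
  | init
  | request
  | receive

/-- The output instructions for the command with binary digits `acc`. -/
def outputs (acc : List Γ') : List GenOut :=
  if acc = trNat 1 then [.append false]
  else if acc = trNat 2 then [.write false, .right]
  else if acc = trNat 3 then [.write true, .right]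
  else [.left]

/-- The statement at which the evaluation of the code `c` starts. -/
def startStmt (c : Code) : Stmt' := tr (trNormal c Cont'.halt)

/-- The transitions of the driver. A round evaluates the code `c` on a list `[b, k, s]`, interprets
the first number of the resulting list `[m, k', s']` as a command, and replaces it by the next
input bit if the command is a request, and by `0` otherwise. -/
def table (c : Code) : State → (Fin (12 + 2) → Bool) → Option (State × List WInstr)
  | .stmt (.push k f q) v, _ => some (.stmt q v, pushInstrs k (f v))
  | .stmt (.peek k f q) v, h => some (.stmt q (f v (top h k)), [])
  | .stmt (.pop k f q) v, h =>
      some (.stmt q (f v (top h k)), if (top h k).isSome then popInstrs k else [])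
  | .stmt (.load a q) v, _ => some (.stmt q (a v), [])
  | .stmt (.branch f q₁ q₂) v, _ => some (.stmt (bif f v then q₁ else q₂) v, [])
  | .stmt (.goto f) v, _ => some (.stmt (tr (f v)) v, [])
  | .stmt .halt _, _ => some (.digits [], [])
  | .digits acc, h =>
      match top h .main with
      | none => none
      | some .cons =>
          if acc = [] then some (.request, popInstrs .main)
          else some (.stmt (startStmt c) none,
            (popInstrs .main ++ pushInstrs .main .cons) ++ (outputs acc).map .output)
      | some a =>
          if acc.length < 3 then some (.digits (acc ++ [a]), popInstrs .main) else none
  | .init, _ => some (.request, pushInstrs .main .cons ++ pushInstrs .main .cons)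
  | .request, _ => some (.receive, [.request])
  | .receive, h => some (.stmt (startStmt c) none,
      pushInstrs .main .cons ++ if h 0 then pushInstrs .main .bit1 else [])

/-- The type of all statements is infinite; only those occurring in the compiled code are kept.
Three digits suffice because commands are at most 4. -/
def support (c : Code) : Set State := fun
  | .stmt s _ => some s ∈ TM2.stmts tr (codeSupp c Cont'.halt)
  | .digits acc => acc.length ≤ 3
  | _ => True

theorem finite_support (c : Code) : (support c).Finite := by
  have h1 : {x : Stmt' × Option Γ' | some x.1 ∈ TM2.stmts tr (codeSupp c Cont'.halt)}.Finite := by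
    have h : {s : Stmt' | some s ∈ TM2.stmts tr (codeSupp c Cont'.halt)}.Finite :=
      (Finset.finite_toSet _).preimage (Option.some_injective _).injOn
    exact (h.prod Set.finite_univ).subset fun x hx => ⟨hx, Set.mem_univ x.2⟩
  refine (((h1.image fun x => State.stmt x.1 x.2).union
    ((List.finite_length_le Γ' 3).image State.digits)).union
    (Set.toFinite {State.init, .request, .receive})).subset ?_
  rintro (⟨s, v⟩ | acc | _ | _ | _) hq
  · exact Or.inl (Or.inl ⟨(s, v), hq, rfl⟩)
  · exact Or.inl (Or.inr ⟨acc, hq, rfl⟩)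
  all_goals right; simp

theorem startStmt_mem (c : Code) :
    some (startStmt c) ∈ TM2.stmts tr (codeSupp c Cont'.halt) :=
  TM2.some_mem_stmts (codeSupp_self _ _ (trStmts₁_self _))

theorem length_pushInstrs (k : K') (a : Γ') : (pushInstrs k a).length = 6 := rfl

theorem length_popInstrs (k : K') : (popInstrs k).length = 3 := rfl

theorem length_outputs_le (acc : List Γ') : (outputs acc).length ≤ 2 := by
  unfold outputs
  split_ifs <;> simp

/-- The bound 12 comes from two pushes of six instructions each; a pop, a push and two output
instructions make only 11. -/
theorem closed (c : Code) : ∀ q ∈ support c, ∀ h, ∀ r ∈ table c q h,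
    r.1 ∈ support c ∧ r.2.length ≤ 12 := by
  have sub : ∀ {s s' : Stmt'}, s' ∈ TM2.stmts₁ s →
      some s ∈ TM2.stmts tr (codeSupp c Cont'.halt) →
      some s' ∈ TM2.stmts tr (codeSupp c Cont'.halt) := fun h => TM2.stmts_trans h
  rintro (⟨s, v⟩ | acc | _ | _ | _) hq h r hr
  · cases s with
    | push k f s =>
      cases hr
      exact ⟨sub TM2.mem_stmts₁_push hq, by simp [length_pushInstrs]⟩
    | peek k f s =>
      cases hr
      exact ⟨sub TM2.mem_stmts₁_peek hq, by simp⟩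
    | pop k f s =>
      cases hr
      refine ⟨sub TM2.mem_stmts₁_pop hq, ?_⟩
      dsimp only
      split_ifs <;> simp [length_popInstrs]
    | load a s =>
      cases hr
      exact ⟨sub TM2.mem_stmts₁_load hq, by simp⟩
    | branch f s₁ s₂ =>
      cases hr
      exact ⟨sub (TM2.mem_stmts₁_branch _) hq, by simp⟩
    | goto f =>
      cases hr
      -- The `Inhabited` instance is given explicitly because the notion of support refers to the
      -- default label, which here has to be the entry point of the compiled code.
      have := @TM2.stmts_supportsStmt _ _ _ _ ⟨trNormal c Cont'.halt⟩ _ _ _ (tr_supports c _) hq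
      exact ⟨TM2.some_mem_stmts (this v), by simp⟩
    | halt =>
      cases hr
      exact ⟨Nat.zero_le _, by simp⟩
  · simp only [table] at hr
    split at hr
    · cases hr
    · split_ifs at hr
      · cases hr
        exact ⟨trivial, by simp [length_popInstrs]⟩
      · cases hr
        refine ⟨startStmt_mem c, ?_⟩
        have := length_outputs_le acc
        simp only [List.length_append, List.length_map, length_popInstrs, length_pushInstrs]
        omega
    · split_ifs at hr with hacc
      · cases hr
        refine ⟨?_, by simp [length_popInstrs]⟩
        show (acc ++ [_]).length ≤ 3
        simpa using hacc
      · cases hr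
  · cases hr
    exact ⟨trivial, by simp [length_pushInstrs]⟩
  · cases hr
    exact ⟨trivial, by simp⟩
  · cases hr
    refine ⟨startStmt_mem c, ?_⟩
    dsimp only
    split_ifs <;> simp [length_pushInstrs]

/-- The driver for the code `c`. -/
noncomputable def machine (c : Code) : GTM :=
  Machine.ofMacro (tbl := table c) (finite_support c) .init trivial (closed c)

end StackDriver

/-! ### Correctness of one round of the driver -/

namespace StackDriver

open Turing PartrecToTM2 ToPartrec

/-- The driver is in state `q` without pending instructions, holds the stacks `S`, has read `r` bits
and has output tape `o`. -/
def At (c : Code) (q : State) (S : K' → List Γ') (r : ℕ) (o : OutTape)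
    (x : Config (machine c)) : Prop :=
  ∃ w, Machine.MacroConfig x q [] w r o ∧ Holds w S

variable {c : Code} {p : Stream'.Seq Bool} {q q' : State} {S S' : K' → List Γ'} {r : ℕ}
  {o : OutTape}

theorem At.out_eq {x : Config (machine c)} (h : At c q S r o x) : x.out = o := by
  obtain ⟨w, h, -⟩ := h
  exact h.2.2.2

theorem leadsPos_work
    (h : ∀ w, Holds w S → ∃ l, (∀ i ∈ l, i.IsWork) ∧
      table c q (fun i => (w i).head) = some (q', l) ∧ Holds (l.foldl Instr.actWork w) S') :
    LeadsPos ((machine c).step p) (fun x => x.out = o) (At c q S r o) (At c q' S' r o) := by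
  rintro x ⟨w, hx, hw⟩
  obtain ⟨l, hl, ht, hS⟩ := h w hw
  obtain ⟨n, h0, hn, hP⟩ := Machine.leads_lookup (p := p) (l' := []) hl
    (by rw [ht, List.append_nil]) (fun _ => rfl) r o x hx
  exact ⟨n, h0, ⟨_, hn, hS⟩, hP⟩

/-- The state of the driver that corresponds to a configuration of the stack machine. -/
def ofCfg (x : Cfg') : State :=
  match x.l with
  | none => .digits []
  | some l => .stmt (tr l) x.var

/-- `TM2.stepAux` runs a statement to its `goto` or `halt` at once, whereas the driver spends one
table lookup on each constructor; hence the induction on the statement. -/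
theorem leads_stmt (s : Stmt') (v : Option Γ') (S : K' → List Γ') :
    Leads ((machine c).step p) (fun x => x.out = o) (At c (.stmt s v) S r o)
      (At c (ofCfg (TM2.stepAux s v S)) (TM2.stepAux s v S).stk r o) := by
  induction s generalizing v S with
  | push k f s ih =>
    exact (leadsPos_work fun w hw => ⟨_, isWork_pushInstrs k (f v), rfl, hw.push k _⟩).leads.trans
      (ih _ _)
  | peek k f s ih =>
    refine (leadsPos_work (q' := .stmt s (f v (S k).head?)) (S' := S)
      fun w hw => ⟨[], by simp, ?_, hw⟩).leads.trans (ih _ _)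
    rw [← hw.top_eq]
    rfl
  | pop k f s ih =>
    refine (leadsPos_work (q' := .stmt s (f v (S k).head?)) (S' := Function.update S k (S k).tail)
      fun w hw => ⟨if (top (fun i => (w i).head) k).isSome then popInstrs k else [], ?_, ?_, ?_⟩
      ).leads.trans (ih _ _)
    · split_ifs
      · exact isWork_popInstrs k
      · simp
    · rw [← hw.top_eq]
      rfl
    · rw [hw.top_eq]
      -- On an empty stack the stack machine replaces `[]` by its tail, again `[]`. The driver then
      -- moves no head, since moving left would leave the bottom marker.
      cases hS : S k with
      | nil =>
        have : Function.update S k [] = S := by rw [← hS, Function.update_eq_self]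
        simpa [this] using hw
      | cons a l => exact hw.pop hS
  | load a s ih =>
    exact (leadsPos_work (S' := S) fun w hw => ⟨[], by simp, rfl, hw⟩).leads.trans (ih _ _)
  | branch f s₁ s₂ ih₁ ih₂ =>
    refine (leadsPos_work (S' := S) fun w hw => ⟨[], by simp, rfl, hw⟩).leads.trans ?_
    rw [TM2.stepAux]
    cases f v
    · exact ih₂ _ _
    · exact ih₁ _ _
  | goto f => exact (leadsPos_work fun w hw => ⟨[], by simp, rfl, hw⟩).leads
  | halt => exact (leadsPos_work fun w hw => ⟨[], by simp, rfl, hw⟩).leads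

theorem leads_reaches {x y : Cfg'} (h : StateTransition.Reaches (TM2.step tr) x y) :
    Leads ((machine c).step p) (fun x => x.out = o) (At c (ofCfg x) x.stk r o)
      (At c (ofCfg y) y.stk r o) := by
  induction h using Relation.ReflTransGen.head_induction_on with
  | refl => exact Leads.of_imp (fun _ => id) fun _ h => h.out_eq
  | head h _ ih =>
    rename_i x x' _
    refine Leads.trans ?_ ih
    obtain ⟨_ | l, v, S⟩ := x
    · cases h
    · cases h
      exact leads_stmt _ _ _

/-- The stacks that hold the list `v` of numbers. -/
def numStacks (v : List ℕ) : K' → List Γ' := K'.elim (trList v) [] [] []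

/-- The correctness theorem `tr_eval` of the compilation also says that the three auxiliary stacks
are empty on halting, so that the next evaluation can start directly from the result. -/
theorem leads_eval {v v' : List ℕ} (h : c.eval v = pure v') :
    Leads ((machine c).step p) (fun x => x.out = o)
      (At c (.stmt (startStmt c) none) (numStacks v) r o) (At c (.digits []) (numStacks v') r o) := by
  have h' : halt v' ∈ StateTransition.eval (TM2.step tr) (PartrecToTM2.init c v) := by
    rw [tr_eval, h]
    exact (Part.mem_map_iff _).2 ⟨_, Part.mem_some _, rfl⟩
  exact leads_reaches (StateTransition.mem_eval.1 h').1

theorem leads_digits {l rest : List Γ'} (acc : List Γ') (hl : ∀ a ∈ l, a ≠ .cons)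
    (hlen : acc.length + l.length ≤ 3) :
    Leads ((machine c).step p) (fun x => x.out = o)
      (At c (.digits acc) (K'.elim (l ++ .cons :: rest) [] [] []) r o)
      (At c (.digits (acc ++ l)) (K'.elim (.cons :: rest) [] [] []) r o) := by
  induction l generalizing acc with
  | nil => exact Leads.of_imp (by simp) fun _ h => h.out_eq
  | cons a l ih =>
    simp only [List.length_cons, List.mem_cons, forall_eq_or_imp] at hlen hl
    have := ih (acc ++ [a]) hl.2 (by simp; omega)
    rw [List.append_assoc] at this
    refine Leads.trans (LeadsPos.leads (leadsPos_work
      fun w hw => ⟨popInstrs .main, isWork_popInstrs _, ?_, ?_⟩)) this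
    · have htop := hw.top_eq .main
      simp only [K'.elim, List.cons_append, List.head?_cons] at htop
      have hacc : acc.length < 3 := by omega
      cases a <;> simp_all [table]
    · rw [← K'.elim_update_main (a := (a :: l) ++ .cons :: rest)]
      exact hw.pop rfl

theorem trNat_ne_cons (m : ℕ) : ∀ a ∈ trNat m, a ≠ .cons := by
  intro a ha h
  have := trNat_natEnd m a ha
  simp [h] at this

theorem length_trNat_le {m : ℕ} (hm : m ≤ 4) : (trNat m).length ≤ 3 := by
  interval_cases m <;> decide

/-- The driver is about to start a round on `[b, k, s]`. -/
def AtRound (c : Code) (b k s r : ℕ) (o : OutTape) : Config (machine c) → Prop :=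
  At c (.stmt (startStmt c) none) (numStacks [b, k, s]) r o

theorem leads_command {b k s m k' s' : ℕ} (hm : m ≤ 4) (h : c.eval [b, k, s] = pure [m, k', s']) :
    Leads ((machine c).step p) (fun x => x.out = o) (AtRound c b k s r o)
      (At c (.digits (trNat m)) (K'.elim (.cons :: trList [k', s']) [] [] []) r o) :=
  (leads_eval h).trans (leads_digits [] (trNat_ne_cons m) (by simpa using length_trNat_le hm))

theorem leads_round_request {b k s k' s' : ℕ} (h : c.eval [b, k, s] = pure [0, k', s']) :
    Leads ((machine c).step p) (fun x => x.out = o) (AtRound c b k s r o)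
      (At c .request (numStacks [k', s']) r o) := by
  refine (leads_command (by omega) h).trans (LeadsPos.leads (leadsPos_work
    fun w hw => ⟨popInstrs .main, isWork_popInstrs _, ?_, ?_⟩))
  · have htop := hw.top_eq .main
    simp only [K'.elim, List.head?_cons] at htop
    simp [table, htop]
  · rw [numStacks, ← K'.elim_update_main (a := .cons :: trList [k', s'])]
    exact hw.pop rfl

/-- The input bit arrives on work tape 0, which carries no stack, and is then pushed as a number:
the separator alone for 0, with the digit `bit1` on top for 1. -/
theorem leads_request {b : Bool} {k s : ℕ} (hp : p.get? r = some b) :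
    LeadsPos ((machine c).step p) (fun x => x.out = o) (At c .request (numStacks [k, s]) r o)
      (AtRound c b.toNat k s (r + 1) o) := by
  rintro x ⟨w, hx, hw⟩
  obtain ⟨n, h0, hn, hP⟩ := Machine.leads_lookup_request (p := p) (l := []) rfl hp x hx
  have hw' := hw.update_zero ((w 0).write b)
  obtain ⟨n', -, hn', hP'⟩ := Machine.leads_lookup (p := p) (l' := [])
    (q' := .stmt (startStmt c) none)
    (l := pushInstrs .main .cons ++ if b then pushInstrs .main .bit1 else [])
    (by
      intro i hi
      rcases List.mem_append.1 hi with hi | hi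
      · exact isWork_pushInstrs _ _ i hi
      · split_ifs at hi
        · exact isWork_pushInstrs _ _ i hi
        · simp at hi)
    (by
      rw [List.append_nil]
      simp only [table, Function.update_self, WorkTape.write])
    (fun _ => rfl) _ _ _ hn
  refine ⟨n' + n, by omega, ⟨_, by rw [Function.iterate_add_apply]; exact hn', ?_⟩,
    iterate_path_add (f := (machine c).step p) (P := fun x => x.out = o) hP hP'⟩
  rw [List.foldl_append]
  have h1 := hw'.push .main .cons
  cases b
  · rw [numStacks, K'.elim_update_main] at h1
    simpa [numStacks] using h1
  · have h2 := h1.push .main .bit1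
    rw [numStacks, K'.elim_update_main, K'.elim_update_main] at h2
    exact h2

/-- The effect of a sequence of output instructions. -/
def actOutputs (l : List GenOut) (o : OutTape) : OutTape :=
  l.foldl (fun o a => OutputInstr.act a [] o) o

theorem str_shiftRight (o : OutTape) : o.shiftRight.str = o.str := by
  unfold OutTape.shiftRight
  split_ifs <;> rfl

theorem step_output {q : State} {l : List WInstr} {w : Fin (12 + 2) → WorkTape} {a : GenOut}
    {x : Config (machine c)} (hx : Machine.MacroConfig x q (.output a :: l) w r o) :
    Machine.MacroConfig ((machine c).step p x) q l w r (OutputInstr.act a [] o) := by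
  have : OutputInstr.act a (w 1).right o = OutputInstr.act a [] o := by cases a <;> rfl
  rw [← this]
  exact hx.step_output

theorem leads_step_output {P : List Bool → Prop} {l : List WInstr} {w : Fin (12 + 2) → WorkTape}
    {a : GenOut} (hP : P o.str) (hP' : P (OutputInstr.act a [] o).str) :
    LeadsPos ((machine c).step p) (fun x => P x.out.str)
      (fun x => Machine.MacroConfig x q (.output a :: l) w r o)
      (fun x => Machine.MacroConfig x q l w r (OutputInstr.act a [] o)) := by
  refine LeadsPos.of_step (fun x hx => step_output hx) ?_ ?_
  · intro x hx
    rw [hx.2.2.2]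
    exact hP
  · intro x hx
    rw [hx.2.2.2]
    exact hP'

/-- A command has at most one instruction that alters the contents of the output, followed at most
by a head movement. So at every instant the contents are those before or those after the command,
and a property of both holds throughout. -/
theorem leads_outputs {P : List Bool → Prop} {acc : List Γ'} {w : Fin (12 + 2) → WorkTape}
    (hP : P o.str) (hP' : P (actOutputs (outputs acc) o).str) :
    Leads ((machine c).step p) (fun x => P x.out.str)
      (fun x => Machine.MacroConfig x q ((outputs acc).map .output) w r o)
      (fun x => Machine.MacroConfig x q [] w r (actOutputs (outputs acc) o)) := by
  have h : ∃ a, outputs acc = [a] ∨ outputs acc = [a, .right] := by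
    unfold outputs
    split_ifs <;> simp
  obtain ⟨a, h | h⟩ := h
  · rw [h] at hP' ⊢
    exact (leads_step_output hP hP').leads
  · rw [h] at hP' ⊢
    have hr : ∀ o' : OutTape, (OutputInstr.act GenOut.right [] o').str = o'.str := str_shiftRight
    simp only [actOutputs, List.foldl, hr] at hP' ⊢
    exact (leads_step_output hP hP').leads.trans (leads_step_output hP' (by rwa [hr])).leads

/-- Once the digits of `m` are popped, the remaining separator already encodes the number 0. Popping
it and pushing it again provides the leading work instructions that `Machine.leads_lookup` demands
before output instructions. -/
theorem leads_round_output {b k s m k' s' : ℕ} (hm : m ≤ 4) (hm0 : m ≠ 0)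
    (h : c.eval [b, k, s] = pure [m, k', s']) {P : List Bool → Prop} (hP : P o.str)
    (hP' : P (actOutputs (outputs (trNat m)) o).str) :
    LeadsPos ((machine c).step p) (fun x => P x.out.str) (AtRound c b k s r o)
      (AtRound c 0 k' s' r (actOutputs (outputs (trNat m)) o)) := by
  have hP0 : ∀ x : Config (machine c), x.out = o → P x.out.str := fun x hx => by rwa [hx]
  refine ((leads_command hm h).mono hP0).trans_leadsPos ?_
  rintro x ⟨w, hx, hw⟩
  have hne : trNat m ≠ [] := by
    intro h0
    interval_cases m <;> simp_all <;> revert h0 <;> decide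
  have htop := hw.top_eq .main
  simp only [K'.elim, List.head?_cons] at htop
  refine (((Machine.leads_lookup (l := popInstrs .main ++ pushInstrs .main .cons)
    (l' := (outputs (trNat m)).map .output) (q' := .stmt (startStmt c) none) ?_ ?_ ?_ r o).mono
    hP0).trans_leads ((leads_outputs hP hP').trans (Leads.of_imp ?_ ?_))) x hx
  · intro i hi
    rcases List.mem_append.1 hi with hi | hi
    · exact isWork_popInstrs _ i hi
    · exact isWork_pushInstrs _ _ i hi
  · simp [table, htop, hne]
  · simp [popInstrs]
  · intro y hy
    refine ⟨_, hy, ?_⟩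
    rw [List.foldl_append]
    have := (hw.pop (k := .main) rfl).push .main .cons
    simpa [numStacks] using this
  · intro y hy
    rw [hy.2.2.2]
    exact hP'

/-- The number 0 has no digits, so two separators encode the list `[0, 0]`. -/
theorem leads_init (c : Code) :
    LeadsPos ((machine c).step p) (fun x => x.out = OutTape.init)
      (fun x => x = (machine c).initConfig) (At c .request (numStacks [0, 0]) 0 OutTape.init) := by
  rintro _ rfl
  refine leadsPos_work (q := .init) (S := K'.elim [] [] [] []) (fun w hw => ⟨_, ?_, rfl, ?_⟩) _
    ⟨_, Machine.macroConfig_initConfig, Holds.init⟩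
  · intro i hi
    rcases List.mem_append.1 hi with hi | hi <;> exact isWork_pushInstrs _ _ i hi
  · rw [List.foldl_append]
    have := (hw.push .main .cons).push .main .cons
    simpa [numStacks] using this

end StackDriver

/-! ### The driver for a table of commands -/

namespace StackDriver

open Turing PartrecToTM2 ToPartrec Filter

/-- One formula serves both phases: a bit 1 increases the parameter `k` and leaves the round counter
`s` alone, while a bit 0 advances `s`. Since 0 also stands for "no bit", `s` keeps advancing after
the input has been read. -/
theorem exists_code_round {cmd : ℕ → ℕ → ℕ} (hcmd : Primrec₂ cmd) : ∃ c : Code, ∀ b k s,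
    c.eval [b, k, s] = pure [cmd (k + b) (s + (1 - b)), k + b, s + (1 - b)] := by
  have hb : Primrec fun v : List.Vector ℕ 3 => v.head := Primrec.vector_head
  have hk : Primrec fun v : List.Vector ℕ 3 => v.tail.head + v.head :=
    Primrec.nat_add.comp (Primrec.vector_head.comp Primrec.vector_tail) hb
  have hs : Primrec fun v : List.Vector ℕ 3 => v.tail.tail.head + (1 - v.head) :=
    Primrec.nat_add.comp
      (Primrec.vector_head.comp (Primrec.vector_tail.comp Primrec.vector_tail))
      (Primrec.nat_sub.comp (Primrec.const 1) hb)
  obtain ⟨c₁, h₁⟩ := Code.exists_code (Nat.Partrec'.of_prim (hcmd.comp hk hs))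
  obtain ⟨c₂, h₂⟩ := Code.exists_code (Nat.Partrec'.of_prim hk)
  obtain ⟨c₃, h₃⟩ := Code.exists_code (Nat.Partrec'.of_prim hs)
  refine ⟨c₁.cons (c₂.cons c₃), fun b k s => ?_⟩
  have e₁ : c₁.eval [b, k, s] = Part.some [cmd (k + b) (s + (1 - b))] :=
    (h₁ ⟨[b, k, s], rfl⟩).trans (Part.map_some _ _)
  have e₂ : c₂.eval [b, k, s] = Part.some [k + b] :=
    (h₂ ⟨[b, k, s], rfl⟩).trans (Part.map_some _ _)
  have e₃ : c₃.eval [b, k, s] = Part.some [s + (1 - b)] :=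
    (h₃ ⟨[b, k, s], rfl⟩).trans (Part.map_some _ _)
  simp [Code.cons_eval, e₁, e₂, e₃]

/-- The output tape after the commands `cmd 1`, ..., `cmd s`. -/
def tapeAfter (cmd : ℕ → ℕ) : ℕ → OutTape
  | 0 => OutTape.init
  | s + 1 => actOutputs (outputs (trNat (cmd (s + 1)))) (tapeAfter cmd s)

/-- The program that makes the driver execute the commands with parameter `k`. -/
def unaryProgram (k : ℕ) : List Bool := List.replicate k true ++ [false]

section Run

variable {cmd : ℕ → ℕ → ℕ} {c : Code} {k : ℕ}

/-- While ones are read the round counter stays 0, and `cmd j 0 = 0` is the request for the next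
bit. -/
theorem exists_request (h0 : ∀ k, cmd k 0 = 0) (hc : ∀ b k s,
    c.eval [b, k, s] = pure [cmd (k + b) (s + (1 - b)), k + b, s + (1 - b)]) {j : ℕ} (hj : j ≤ k) :
    ∃ t, At c .request (numStacks [j, 0]) j OutTape.init
      ((machine c).run (Stream'.Seq.ofList (unaryProgram k)) t) := by
  induction j with
  | zero =>
    obtain ⟨n, -, hn, -⟩ := leads_init c (p := Stream'.Seq.ofList (unaryProgram k)) _ rfl
    exact ⟨n, hn⟩
  | succ j ih =>
    obtain ⟨t, ht⟩ := ih (by omega)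
    have hp : (Stream'.Seq.ofList (unaryProgram k)).get? j = some true := by
      rw [Stream'.Seq.ofList_get?, unaryProgram, List.getElem?_append_left (by simpa using hj),
        List.getElem?_replicate_of_lt (by omega)]
    have hr := hc 1 j 0
    simp only [Nat.sub_self, add_zero, h0] at hr
    obtain ⟨n, hn, -⟩ := ((leads_request hp).leads.trans (leads_round_request hr)) _ ht
    exact ⟨n + t, by rwa [Machine.run, Function.iterate_add_apply]⟩

theorem exists_round (h0 : ∀ k, cmd k 0 = 0) (hc : ∀ b k s,
    c.eval [b, k, s] = pure [cmd (k + b) (s + (1 - b)), k + b, s + (1 - b)]) (k : ℕ) :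
    ∃ t, AtRound c 0 k 0 (k + 1) (tapeAfter (cmd k) 0)
      ((machine c).run (Stream'.Seq.ofList (unaryProgram k)) t) := by
  obtain ⟨t, ht⟩ := exists_request h0 hc (le_refl k)
  have hp : (Stream'.Seq.ofList (unaryProgram k)).get? k = some false := by
    rw [Stream'.Seq.ofList_get?, unaryProgram, List.getElem?_append_right (by simp)]
    simp
  obtain ⟨n, -, hn, -⟩ := leads_request hp _ ht
  exact ⟨n + t, by rwa [Machine.run, Function.iterate_add_apply]⟩

theorem leads_tapeAfter {p : Stream'.Seq Bool} {r : ℕ} (h4 : ∀ k s, cmd k s ≤ 4)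
    (hpos : ∀ k s, cmd k (s + 1) ≠ 0) (hc : ∀ b k s,
      c.eval [b, k, s] = pure [cmd (k + b) (s + (1 - b)), k + b, s + (1 - b)]) (s : ℕ)
    {P : List Bool → Prop} (hP : P (tapeAfter (cmd k) s).str)
    (hP' : P (tapeAfter (cmd k) (s + 1)).str) :
    LeadsPos ((machine c).step p) (fun x => P x.out.str)
      (AtRound c 0 k s r (tapeAfter (cmd k) s))
      (AtRound c 0 k (s + 1) r (tapeAfter (cmd k) (s + 1))) :=
  leads_round_output (h4 _ _) (hpos _ _) (hc 0 k s) hP hP'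

/-- A Turing machine that reads the program `unaryProgram k` and then forever executes the
commands `cmd k 1`, `cmd k 2`, ... -/
theorem exists_gtm (hcmd : Primrec₂ cmd) (h4 : ∀ k s, cmd k s ≤ 4) (h0 : ∀ k, cmd k 0 = 0)
    (hpos : ∀ k s, cmd k (s + 1) ≠ 0) : ∃ T : GTM, ∀ (k : ℕ) (z : List Bool),
      (∀ᶠ s in atTop, (tapeAfter (cmd k) s).str = z) →
        T.ConvergesTo (Stream'.Seq.ofList (unaryProgram k)) (Stream'.Seq.ofList z) := by
  obtain ⟨c, hc⟩ := exists_code_round hcmd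
  refine ⟨machine c, fun k z hz => Machine.convergesTo_ofList_iff.2 ?_⟩
  set p := Stream'.Seq.ofList (unaryProgram k) with hp
  obtain ⟨t₀, ht₀⟩ := exists_round h0 hc k
  have hround : ∀ N, ∃ t ≥ N, AtRound c 0 k N (k + 1) (tapeAfter (cmd k) N)
      ((machine c).run p t) := fun N => by
    -- The trivial property suffices here: only the fact that each round is reached, arbitrarily
    -- late, matters.
    obtain ⟨t, ht, h⟩ := LeadsPos.exists_iterate (s := 0) (P := fun _ _ => True)
      (A := fun s => AtRound c 0 k s (k + 1) (tapeAfter (cmd k) s)) (f := (machine c).step p)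
      (fun s _ => leads_tapeAfter (P := fun _ => True) h4 hpos hc s trivial trivial) ht₀ N
    rw [zero_add, Machine.run, ← Function.iterate_add_apply] at h
    exact ⟨t + t₀, by omega, h⟩
  refine ⟨⟨fun t hreq => ?_, fun i hi => ⟨t₀, ?_⟩⟩, ?_⟩
  · by_contra hnone
    have hstuck {t'} (h : t ≤ t') := Machine.run_eq_of_step_eq
      (Machine.step_eq_of_requests hreq (by simpa using hnone)) h
    obtain ⟨t', ht', hA⟩ := hround t
    obtain ⟨n, hB, -⟩ := leads_command (p := p) (h4 _ _) (hc 0 k t) _ hA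
    rw [Machine.run, ← Function.iterate_add_apply, ← Machine.run, hstuck (by omega)] at hB
    rw [hstuck ht'] at hA
    obtain ⟨w, hw, -⟩ := hA
    obtain ⟨w', hw', -⟩ := hB
    have := hw.1.symm.trans hw'.1
    simp at this
  · obtain ⟨w, hw, -⟩ := ht₀
    rw [hw.2.2.1]
    rw [hp, Stream'.Seq.ofList_get?] at hi
    simpa [unaryProgram] using hi
  · obtain ⟨s, hs⟩ := eventually_atTop.1 hz
    obtain ⟨t, -, ht⟩ := hround s
    refine eventually_atTop.2 ⟨t, fun t' ht' => ?_⟩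
    -- From round `s` on the tape holds `z` after every round; applying the invariant "the contents
    -- are `z`" covers the instants inside the rounds as well.
    have := LeadsPos.forall_iterate (s := s) (P := fun x => x.out.str = z)
      (A := fun s => AtRound c 0 k s (k + 1) (tapeAfter (cmd k) s)) (f := (machine c).step p)
      (fun i hi => leads_tapeAfter (P := fun l => l = z) h4 hpos hc i (hs i hi)
        (hs (i + 1) (by omega))) ht (t' - t)
    rwa [Machine.run, ← Function.iterate_add_apply, Nat.sub_add_cancel ht'] at this

end Run

/-! ### Writing a string that is computable in the limit -/

/-- The command of round `s` that brings the output closer to the string `z` of length `n`: the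
first `n` rounds create the squares, and afterwards the head sweeps over them, writing on its way
to the right. -/
def writeCommand (n : ℕ) (z : List Bool) (s : ℕ) : ℕ :=
  if s = 0 then 0
  else if s ≤ n then 1
  else if (s - 1) % (2 * n) < n then (if z.getD ((s - 1) % (2 * n)) false then 3 else 2)
  else 4

theorem writeCommand_le (n : ℕ) (z : List Bool) (s : ℕ) : writeCommand n z s ≤ 4 := by
  unfold writeCommand
  split_ifs <;> omega

theorem writeCommand_succ_ne (n : ℕ) (z : List Bool) (s : ℕ) : writeCommand n z (s + 1) ≠ 0 := by
  simp only [writeCommand, Nat.add_one_ne_zero, if_false]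
  split_ifs <;> simp

theorem primrec_writeCommand {α : Type*} [Primcodable α] {n s : α → ℕ} {z : α → List Bool}
    (hn : Primrec n) (hz : Primrec z) (hs : Primrec s) :
    Primrec fun a => writeCommand (n a) (z a) (s a) := by
  have hj : Primrec fun a => (s a - 1) % (2 * n a) :=
    Primrec.nat_mod.comp (Primrec.nat_sub.comp hs (Primrec.const 1))
      (Primrec.nat_mul.comp (Primrec.const 2) hn)
  exact Primrec.ite (Primrec.eq.comp hs (Primrec.const 0)) (Primrec.const 0)
    (Primrec.ite (Primrec.nat_le.comp hs hn) (Primrec.const 1)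
      (Primrec.ite (Primrec.nat_lt.comp hj hn)
        (Primrec.ite (Primrec.eq.comp ((Primrec.list_getD false).comp hz hj) (Primrec.const true))
          (Primrec.const 3) (Primrec.const 2)) (Primrec.const 4)))

theorem actOutputs_one (o : OutTape) : actOutputs (outputs (trNat 1)) o = o.append false := rfl

theorem actOutputs_two (o : OutTape) :
    actOutputs (outputs (trNat 2)) o = (o.write false).shiftRight := rfl

theorem actOutputs_three (o : OutTape) :
    actOutputs (outputs (trNat 3)) o = (o.write true).shiftRight := rfl

theorem actOutputs_four (o : OutTape) : actOutputs (outputs (trNat 4)) o = o.shiftLeft := rfl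

/-! ### The sweeping output head -/

section Write

variable {n : ℕ} {g : ℕ → List Bool}

/-- The output tape after `s` rounds in which the target string is `g 1`, ..., `g s`. -/
def writtenTape (n : ℕ) (g : ℕ → List Bool) : ℕ → OutTape :=
  tapeAfter fun s => writeCommand n (g s) s

theorem writtenTape_succ_of_lt {s : ℕ} (hs : s < n) :
    writtenTape n g (s + 1) = (writtenTape n g s).append false := by
  rw [← actOutputs_one, writtenTape, tapeAfter, writeCommand, if_neg (by omega), if_pos (by omega)]

theorem writtenTape_succ_of_mod_lt {s : ℕ} (hs : n ≤ s) (h : s % (2 * n) < n) :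
    writtenTape n g (s + 1) =
      ((writtenTape n g s).write ((g (s + 1)).getD (s % (2 * n)) false)).shiftRight := by
  rw [writtenTape, tapeAfter, writeCommand, if_neg (by omega), if_neg (by omega),
    Nat.add_sub_cancel, if_pos h]
  cases (g (s + 1)).getD (s % (2 * n)) false
  · exact actOutputs_two _
  · exact actOutputs_three _

theorem writtenTape_succ_of_le_mod {s : ℕ} (hs : n ≤ s) (h : n ≤ s % (2 * n)) :
    writtenTape n g (s + 1) = (writtenTape n g s).shiftLeft := by
  rw [← actOutputs_four, writtenTape, tapeAfter, writeCommand, if_neg (by omega),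
    if_neg (by omega), Nat.add_sub_cancel, if_neg (by omega)]

theorem writtenTape_of_le {s : ℕ} (hs : s ≤ n) :
    writtenTape n g s = ⟨List.replicate s false, 0⟩ := by
  induction s with
  | zero => rfl
  | succ s ih =>
    rw [writtenTape_succ_of_lt (by omega), ih (by omega), OutTape.append, List.replicate_succ']

/-- Rounds `n + 1` to `2 * n` are idle left moves at the first square; they make the first sweep
start at a multiple of the period `2 * n`. -/
theorem writtenTape_add_of_le {s : ℕ} (hs : s ≤ n) :
    writtenTape n g (n + s) = ⟨List.replicate n false, 0⟩ := by
  induction s with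
  | zero => exact writtenTape_of_le le_rfl
  | succ s ih =>
    have h : (n + s) % (2 * n) = n + s := Nat.mod_eq_of_lt (by omega)
    rw [← add_assoc, writtenTape_succ_of_le_mod (by omega) (by omega), ih (by omega)]
    rfl

theorem succ_mod_two_mul (hn : 0 < n) (s : ℕ) :
    (s + 1) % (2 * n) = if s % (2 * n) + 1 = 2 * n then 0 else s % (2 * n) + 1 := by
  have hlt := Nat.mod_lt s (show 2 * n > 0 by omega)
  rw [Nat.add_mod, Nat.mod_eq_of_lt (show 1 < 2 * n by omega)]
  split_ifs with h
  · rw [h, Nat.mod_self]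
  · exact Nat.mod_eq_of_lt (by omega)

/-- The moves out of bounds have no effect, so the head stays twice at either end, and its position
is a symmetric zigzag of period `2 * n`. -/
theorem writtenTape_length_pos (hn : 0 < n) {s : ℕ} (hs : 2 * n ≤ s) :
    (writtenTape n g s).str.length = n ∧
      (writtenTape n g s).pos = min (s % (2 * n)) (2 * n - 1 - s % (2 * n)) := by
  induction s, hs using Nat.le_induction with
  | base =>
    rw [two_mul, writtenTape_add_of_le le_rfl]
    simp
  | succ s hs ih =>
    obtain ⟨hl, hpos⟩ := ih
    have hlt := Nat.mod_lt s (show 2 * n > 0 by omega)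
    rw [succ_mod_two_mul hn]
    rcases lt_or_ge (s % (2 * n)) n with h | h
    · rw [writtenTape_succ_of_mod_lt (by omega) h, OutTape.shiftRight]
      simp only [OutTape.write, List.length_set, hl, hpos]
      clear hpos
      generalize s % (2 * n) = j at h hlt ⊢
      split_ifs <;> simp only [List.length_set, hl, true_and] <;> omega
    · rw [writtenTape_succ_of_le_mod (by omega) h]
      simp only [OutTape.shiftLeft, hl, hpos, true_and]
      clear hpos
      generalize s % (2 * n) = j at h hlt ⊢
      split_ifs <;> omega

theorem writtenTape_str_succ_of_mod_lt (hn : 0 < n) {s : ℕ} (hs : 2 * n ≤ s)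
    (h : s % (2 * n) < n) : (writtenTape n g (s + 1)).str =
      (writtenTape n g s).str.set (s % (2 * n)) ((g (s + 1)).getD (s % (2 * n)) false) := by
  have hpos : (writtenTape n g s).pos = s % (2 * n) := by
    rw [(writtenTape_length_pos hn hs).2]
    omega
  rw [writtenTape_succ_of_mod_lt (by omega) h, str_shiftRight, OutTape.write, hpos]

/-- Once the target is constantly `z`, the next visit to square `i` on the way right writes the
correct bit. Later visits write the same bit, and no other round touches this square. -/
theorem eventually_writtenTape_getD {z : List Bool} (hn : 0 < n)
    (hz : ∀ᶠ s in atTop, g s = z) {i : ℕ} (hi : i < n) :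
    ∀ᶠ s in atTop, (writtenTape n g s).str.getD i false = z.getD i false := by
  obtain ⟨s₀, hs₀⟩ := eventually_atTop.1 hz
  have hle : s₀ + 1 ≤ 2 * n * (s₀ + 1) := Nat.le_mul_of_pos_left _ (by omega)
  have hle' : 2 * n ≤ 2 * n * (s₀ + 1) := Nat.le_mul_of_pos_right _ (by omega)
  -- The time `2 * n * (s₀ + 1)` begins a sweep and is past both `s₀` and the creation of the
  -- squares; square `i` is written `i + 1` rounds later.
  refine eventually_atTop.2 ⟨2 * n * (s₀ + 1) + i + 1, fun s hs => ?_⟩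
  have key : ∀ t ≥ 2 * n * (s₀ + 1), t % (2 * n) = i →
      (writtenTape n g (t + 1)).str.getD i false = z.getD i false := by
    intro t ht hti
    have hl := (writtenTape_length_pos (g := g) hn (hle'.trans ht)).1
    rw [writtenTape_str_succ_of_mod_lt hn (hle'.trans ht) (by omega), hti, hs₀ _ (by omega),
      List.getD_eq_getElem?_getD, List.getElem?_set_self (by omega), Option.getD_some]
  induction s, hs using Nat.le_induction with
  | base =>
    refine key _ (by omega) ?_
    rw [Nat.mul_add_mod, Nat.mod_eq_of_lt (by omega)]
  | succ s hs ih =>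
    by_cases h : s % (2 * n) = i
    · exact key _ (by omega) h
    · rw [← ih]
      rcases lt_or_ge (s % (2 * n)) n with h' | h'
      · rw [writtenTape_str_succ_of_mod_lt hn (by omega) h', List.getD_eq_getElem?_getD,
          List.getElem?_set_ne h, List.getD_eq_getElem?_getD]
      · rw [writtenTape_succ_of_le_mod (by omega) h']
        rfl

theorem eventually_writtenTape {z : List Bool} (hn : 0 < n) (hzn : z.length = n)
    (hz : ∀ᶠ s in atTop, g s = z) : ∀ᶠ s in atTop, (writtenTape n g s).str = z := by
  have h : ∀ᶠ s in atTop, ∀ i ∈ Set.Iio n,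
      (writtenTape n g s).str.getD i false = z.getD i false :=
    (eventually_all_finite (Set.finite_Iio n)).2 fun i hi => eventually_writtenTape_getD hn hz hi
  filter_upwards [h, eventually_ge_atTop (2 * n)] with s hs hs'
  have hl := (writtenTape_length_pos (g := g) hn hs').1
  refine List.ext_getElem (by omega) fun i h1 h2 => ?_
  have := hs i (Set.mem_Iio.2 (by omega))
  rwa [List.getD_eq_getElem _ _ h1, List.getD_eq_getElem _ _ h2] at this

end Write

theorem primrec_two_pow : Primrec fun k : ℕ => 2 ^ k :=
  (Primrec₂.unpaired'.1 Nat.Primrec.pow).comp (Primrec.const 2) Primrec.id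

/-- There is a general Turing machine that converges, on a program of length `k + 1`, to the limit
of `g (2 ^ k)` if this is a string of length `2 ^ k`. -/
theorem exists_gtm_limit {g : ℕ → ℕ → List Bool} (hg : Primrec₂ g) :
    ∃ T : GTM, ∀ (k : ℕ) (z : List Bool), z.length = 2 ^ k →
      (∀ᶠ t in atTop, g (2 ^ k) t = z) →
        T.ConvergesTo (Stream'.Seq.ofList (unaryProgram k)) (Stream'.Seq.ofList z) := by
  have hN : Primrec fun a : ℕ × ℕ => 2 ^ a.1 := primrec_two_pow.comp Primrec.fst
  obtain ⟨T, hT⟩ := exists_gtm (cmd := fun k s => writeCommand (2 ^ k) (g (2 ^ k) s) s)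
    (primrec_writeCommand hN (hg.comp hN Primrec.snd) Primrec.snd)
    (fun _ _ => writeCommand_le _ _ _) (fun _ => rfl) (fun _ _ => writeCommand_succ_ne _ _ _)
  exact ⟨T, fun k z hz hlim => hT k z (eventually_writtenTape (by positivity) hz hlim)⟩

end StackDriver

/-! ### An enumerable output machine that prints a given string -/

namespace Printer

instance : Finite EnumOut := by
  refine Finite.of_injective (β := Fin 3) (fun | .left => 0 | .right => 1 | .replace => 2) ?_
  rintro (_ | _ | _) (_ | _ | _) h <;> simp_all

/-- Write `z` to the right of the head of the second work tape. -/
def instrs : List Bool → List (Instr 0 EnumOut)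
  | [] => []
  | b :: z => instrs z ++ [.write 1 b, .left 1]

theorem isWork_instrs (z : List Bool) : ∀ i ∈ instrs z, i.IsWork := by
  induction z with
  | nil => simp [instrs]
  | cons b z ih =>
    intro i hi
    simp only [instrs, List.mem_append, List.mem_cons, List.not_mem_nil, or_false] at hi
    rcases hi with hi | rfl | rfl
    · exact ih i hi
    · trivial
    · trivial

/-- The bits are written from last to first, the head moving left each time, so that it ends just to
the left of `z`. -/
theorem foldl_instrs (z : List Bool) :
    (instrs z).foldl Instr.actWork (fun _ => WorkTape.init) 1 = ⟨[], false, z⟩ := by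
  induction z with
  | nil => rfl
  | cons b z ih =>
    rw [instrs, List.foldl_append]
    simp [Instr.actWork, ih, WorkTape.write, WorkTape.shiftLeft]

def table (z : List Bool) : Bool → (Fin 2 → Bool) → Option (Bool × List (Instr 0 EnumOut))
  | false, _ => some (true, instrs z ++ [.output .replace])
  | true, _ => none

theorem closed (z : List Bool) : ∀ q ∈ Set.univ, ∀ h, ∀ r ∈ table z q h,
    r.1 ∈ Set.univ ∧ r.2.length ≤ (instrs z).length + 1 := by
  rintro (_ | _) _ h r hr <;> cases hr
  simp

/-- A machine that prints `z`. -/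
noncomputable def machine (z : List Bool) : EOM :=
  Machine.ofMacro (tbl := table z) Set.finite_univ false trivial (closed z)

theorem next_eq_none {z : List Bool} {c : Config (machine z)} (h : c.state.1 = (true, [])) :
    (machine z).next c = none := by
  have : Machine.macroTable (table z) c.state.1 (fun j => (c.work j).head) = none := by
    rw [h]
    rfl
  exact Machine.next_ofMacro_eq_none this

/-- The machine requests nothing, so the empty string is a program. Replacing the empty output by
`z` is an increase because `z` is nonempty. -/
theorem convergesTo {z : List Bool} (hz : z ≠ []) :
    (machine z).ConvergesTo (Stream'.Seq.ofList []) (Stream'.Seq.ofList z) := by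
  have hne : instrs z ≠ [] := by
    cases z <;> simp_all [instrs]
  obtain ⟨n, -, hn, -⟩ := Machine.leads_lookup (hA := Set.finite_univ) (start := false)
    (hstart := trivial) (closed := closed z) (q := false)
    (w := fun _ => WorkTape.init) (q' := true) (l := instrs z) (l' := [.output .replace])
    (p := Stream'.Seq.ofList []) (isWork_instrs z) rfl
    (fun h => absurd h hne) 0 OutTape.init _ Machine.macroConfig_initConfig
  have hm : Machine.MacroConfig ((machine z).run (Stream'.Seq.ofList []) (n + 1)) true []
      ((instrs z).foldl Instr.actWork fun _ => WorkTape.init) 0 (OutTape.init.replace z) := by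
    have := hn.step_output (p := Stream'.Seq.ofList [])
    rw [foldl_instrs] at this
    rwa [Machine.run, Function.iterate_succ_apply']
  set p : Stream'.Seq Bool := Stream'.Seq.ofList []
  have hnone := next_eq_none hm.1
  have hhalt {t} (h : n + 1 ≤ t) := Machine.run_eq_of_step_eq (T := machine z) (p := p)
    (by rw [Machine.step, hnone]) h
  refine Machine.convergesTo_ofList_iff.2 ⟨⟨fun t hreq => ?_, fun i hi => ?_⟩,
    Filter.eventually_atTop.2 ⟨n + 1, fun t ht => ?_⟩⟩
  · exfalso
    -- A request on the empty input would freeze the machine in a requesting configuration, yet from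
    -- time `n + 1` on it has halted.
    have hstuck := Machine.run_eq_of_step_eq
      (Machine.step_eq_of_requests hreq (p := p) (by simp [p])) (le_max_left t (n + 1))
    rw [hhalt (le_max_right t (n + 1))] at hstuck
    obtain ⟨q, hq⟩ := hreq
    rw [← hstuck, hnone] at hq
    cases hq
  · simp [p] at hi
  · rw [Machine.outputAt, hhalt ht, hm.2.2.2]
    have : ([] : List Bool) < z := by
      cases z
      · exact absurd rfl hz
      · exact List.nil_lt_cons _ _
    simp [OutTape.replace, OutTape.init, this]

end Printer

/-! ### The gap between the complexities -/

namespace Machine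

variable {O : Type} [OutputInstr O] {T : Machine O} {x : Stream'.Seq Bool}

theorem exists_complexity_eq {p : List Bool} (h : T.ConvergesTo (Stream'.Seq.ofList p) x) :
    ∃ k : ℕ, T.complexity x = k ∧ k ≤ p.length := by
  have hle : T.complexity x ≤ p.length :=
    iInf_le (fun p : {p : List Bool // T.ConvergesTo (Stream'.Seq.ofList p) x} =>
      (p.val.length : ℕ∞)) ⟨p, h⟩
  obtain ⟨k, hk⟩ := ENat.ne_top_iff_exists.1 (ne_top_of_le_ne_top (ENat.natCast_ne_top _) hle)
  rw [← hk, Nat.cast_le] at hle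
  exact ⟨k, hk.symm, hle⟩

theorem le_complexity {n : ℕ}
    (h : ∀ p : List Bool, T.ConvergesTo (Stream'.Seq.ofList p) x → n ≤ p.length) :
    (n : ℕ∞) ≤ T.complexity x :=
  le_iInf fun p => Nat.cast_le.2 (h p.1 p.2)

end Machine

open Filter in
theorem exists_complexity_gap (UE : EOM) (hUE : UE.IsUniversal) (UG : GTM) (hUG : UG.IsUniversal) :
    ∃ a : ℕ, ∀ k : ℕ, ∃ (z : List Bool) (kE kG : ℕ),
      UE.complexity (Stream'.Seq.ofList z) = kE ∧
      UG.complexity (Stream'.Seq.ofList z) = kG ∧ 2 ^ k ≤ kE ∧ kG ≤ a + k := by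
  obtain ⟨T, hT⟩ := StackDriver.exists_gtm_limit
    (UE.primrec_freshString_shortOutputs EnumOut.primrec_act)
  obtain ⟨c, hc⟩ := hUG T
  -- The compiler of the fixed machine `T`, plus the 0 that terminates the unary program.
  refine ⟨c.length + 1, fun k => ?_⟩
  obtain ⟨z, hzl, hz⟩ := UE.eventually_freshString_shortOutputs (2 ^ k)
  have hG := hc _ _ (hT k z hzl (hz.mono fun _ h => h.1))
  rw [← Stream'.Seq.ofList_append] at hG
  obtain ⟨kG, hkG, hkG'⟩ := Machine.exists_complexity_eq hG
  have hz0 : z ≠ [] := by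
    rintro rfl
    exact (Nat.two_pow_pos k).ne hzl
  -- This compiler depends on `z`; it yields finiteness of the complexity but no uniform bound.
  obtain ⟨d, hd⟩ := hUE (Printer.machine z)
  have hE := hd _ _ (Printer.convergesTo hz0)
  rw [← Stream'.Seq.ofList_append] at hE
  obtain ⟨kE, hkE, -⟩ := Machine.exists_complexity_eq hE
  refine ⟨z, kE, kG, hkE, hkG, ?_, ?_⟩
  · have : ((2 ^ k : ℕ) : ℕ∞) ≤ UE.complexity (Stream'.Seq.ofList z) := by
      refine Machine.le_complexity fun p hp => ?_
      by_contra hlt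
      -- A program shorter than `2 ^ k` converging to `z` would output `z` at some late time, when
      -- `z` is avoided by all short inputs.
      obtain ⟨t, ht, ht'⟩ := ((Machine.convergesTo_ofList_iff.1 hp).2.and hz).exists
      exact ht'.2 (List.mem_map.2 ⟨p, mem_stringsBelow.2 (not_le.1 hlt), ht⟩)
    rwa [hkE, Nat.cast_le] at this
  · simp only [List.length_append, StackDriver.unaryProgram, List.length_replicate,
      List.length_singleton] at hkG'
    omega

/-- `UE` is the universal EOM that defines `K^E`, and `UG` the universal GTM that defines `K^G`. -/
theorem theorem3p3 (UE : EOM) (hUE : UE.IsUniversal) (UG : GTM) (hUG : UG.IsUniversal) :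
    (∃ c : ℝ, 0 < c ∧ ∀ n : ℕ, 1 ≤ n → ∃ (z : List Bool) (kE kG : ℕ),
      UE.complexity (Stream'.Seq.ofList z) = kE ∧
      UG.complexity (Stream'.Seq.ofList z) = kG ∧
      (n : ℝ) - c < kE ∧
      (2 ≤ n → (kG : ℝ) ≤ c * Real.logb 2 n)) ∧
    (∀ m : ℕ, ∃ (z : List Bool) (kE kG : ℕ),
      UE.complexity (Stream'.Seq.ofList z) = kE ∧
      UG.complexity (Stream'.Seq.ofList z) = kG ∧
      kG + m < kE) := by
  obtain ⟨a, ha⟩ := exists_complexity_gap UE hUE UG hUG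
  -- With `k = Nat.clog 2 n`, `kG ≤ a + k ≤ a + 1 + logb 2 n`, and `1 ≤ logb 2 n` for `n ≥ 2`
  -- absorbs `a + 1` into the factor `a + 2`.
  refine ⟨⟨a + 2, by positivity, fun n _ => ?_⟩, fun m => ?_⟩
  · obtain ⟨z, kE, kG, hE, hG, hE', hG'⟩ := ha (Nat.clog 2 n)
    refine ⟨z, kE, kG, hE, hG, ?_, fun hn2 => ?_⟩
    · have h : (n : ℝ) ≤ kE := by exact_mod_cast (Nat.le_pow_clog one_lt_two n).trans hE'
      have ha0 : (0 : ℝ) ≤ a := a.cast_nonneg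
      linarith
    · have hn0 : (0 : ℝ) < n := by exact_mod_cast (by omega : 0 < n)
      have h1 : 1 ≤ Real.logb 2 n := by
        rw [Real.le_logb_iff_rpow_le one_lt_two hn0, Real.rpow_one]
        exact_mod_cast hn2
      have h2 : (Nat.clog 2 n : ℝ) ≤ Real.logb 2 n + 1 := by
        have hpos : 0 < Nat.clog 2 n := Nat.clog_pos one_lt_two hn2
        have hlt : 2 ^ (Nat.clog 2 n).pred < n := Nat.pow_pred_clog_lt_self one_lt_two hn2
        have : ((Nat.clog 2 n).pred : ℝ) ≤ Real.logb 2 n := by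
          rw [Real.le_logb_iff_rpow_le one_lt_two hn0, Real.rpow_natCast]
          exact_mod_cast hlt.le
        have hc : (Nat.clog 2 n : ℝ) = (Nat.clog 2 n).pred + 1 := by
          exact_mod_cast (Nat.succ_pred_eq_of_pos hpos).symm
        linarith
      have h3 : (kG : ℝ) ≤ a + Nat.clog 2 n := by exact_mod_cast hG'
      nlinarith [mul_le_mul_of_nonneg_left h1 (a.cast_nonneg (α := ℝ))]
  -- This `k` gives `kE ≥ 2 * 2 ^ (a + m) ≥ 2 * (a + m + 1)`, whereas `kG + m ≤ 2 * a + 2 * m + 1`.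
  · obtain ⟨z, kE, kG, hE, hG, hE', hG'⟩ := ha (a + m + 1)
    refine ⟨z, kE, kG, hE, hG, ?_⟩
    have : a + m < 2 ^ (a + m) := Nat.lt_two_pow_self
    rw [pow_succ] at hE'
    omega
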